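/- **Notation.** Let $\mathbf d,\mathbf L\in\mathbb N=\{1,2,\dots\}$, $\mathbf l=(\mathbf l_0,\dots,\mathbf l_{\mathbf L})\in\mathbb N^{\mathbf L+1}$ with $\mathbf d\ge\sum_{i=1}^{\mathbf L}\mathbf l_i(\mathbf l_{i-1}+1)$, and $\theta=(\theta_1,\dots,\theta_{\mathbf d})\in\mathbb R^{\mathbf d}$. For $m,n\in\mathbb N$, $s\in\mathbb N_0$ with $s+mn+m\le\mathbf d$ let $\mathscr A^{\theta,s}_{m,n}\colon\mathbb R^n\to\mathbb R^m$ be the affine function with $$\bigl(\mathscr A^{\theta,s}_{m,n}(x)\bigr)_i=\sum_{j=1}^n\theta_{s+(i-1)n+j}\,x_j+\theta_{s+mn+i},\qquad i\in\{1,\dots,m\}.$$ For $u<v$ let $\mathscr N^{\theta,\mathbf l}_{u,v}\colon\mathbb R^{\mathbf l_0}\to\mathbb R^{\mathbf l_{\mathbf L}}$ be the rectified clipped network $$\mathscr N^{\theta,\mathbf l}_{u,v}=\mathbf a_{\mathbf L}\circ\mathscr A^{\theta,s_{\mathbf L}}_{\mathbf l_{\mathbf L},\mathbf l_{\mathbf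 L-1}}\circ\mathbf a_{\mathbf L-1}\circ\mathscr A^{\theta,s_{\mathbf L-1}}_{\mathbf l_{\mathbf L-1},\mathbf l_{\mathbf L-2}}\circ\cdots\circ\mathbf a_1\circ\mathscr A^{\theta,s_1}_{\mathbf l_1,\mathbf l_0},\qquad s_k=\sum_{i=1}^{k-1}\mathbf l_i(\mathbf l_{i-1}+1),$$ where $\mathbf a_k$ applies $x\mapsto\max\{x,0\}$ to each component for $k<\mathbf L$ and $\mathbf a_{\mathbf L}$ applies $x\mapsto\max\{\min\{x,v\},u\}$ to each component. $\|\cdot\|_\infty$ denotes the maximum norm, and $\mathbb R^1$ is identified with $\mathbb R$. **Theorem.** Let $\mathbf d,\mathbf L,M,K,N\in\mathbb N$, $A,p\in(0,\infty)$, $L\in[0,\infty)$, $a,u\in\mathbb R$, $v\in(u,\infty)$, $b\in(a,\infty)$, $c\in[\max\{1,|u|,|v|,|a|,|b|,2L\},\infty)$, $\beta\in[c,\infty)$, $\mathbf l=(\mathbf l_0,\dots,\mathbf l_{\mathbf L})\in\mathbb N^{\mathbf L+1}$, $\mathfrak N\subseteq\{0,1,\dots,N\}$ satisfy $0\in\mathfrak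 N$, $\mathbf L\ge2$, $\mathbf l_0=\mathbf l_{\mathbf L}=1$, $\mathbf l_1\ge A+2$, $\mathbf d\ge\sum_{i=1}^{\mathbf L}\mathbf l_i(\mathbf l_{i-1}+1)$, and $\mathbf l_i\ge2$ for all $i\in\{2,\dots,\mathbf L-1\}$. Let $(\Omega,\mathcal F,\mathbb P)$ be a probability space, let $(X_j,Y_j)\colon\Omega\to[a,b]\times[u,v]$, $j\in\{1,\dots,M\}$, be i.i.d. random variables, and let $\mathcal E\colon[a,b]\to[u,v]$ satisfy $\mathcal E(X_1)=\mathbb E[Y_1|X_1]$ $\mathbb P$-a.s. and $|\mathcal E(x)-\mathcal E(y)|\le L|x-y|$ for all $x,y\in[a,b]$. Let $\Theta_{k,n}\colon\Omega\to\mathbb R^{\mathbf d}$, $k,n\in\mathbb N_0$, and $\mathbf k\colon\Omega\to(\mathbb N_0)^2$ be random variables such that $\Theta_{k,0}$, $k\in\{1,\dots,K\}$, are i.i.d. and $\Theta_{1,0}$ is uniformly distributed on $[-c,c]^{\mathbf d}$ (no independence from the $(X_j,Y_j)$ and no further relation between the $\Theta_{k,n}$ is assumed). Let $$\mathcal R(\theta,\omega)=\frac1M\sum_{j=1}^M\bigl|\mathscr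 N^{\theta,\mathbf l}_{u,v}(X_j(\omega))-Y_j(\omega)\bigr|^2,\qquad\theta\in\mathbb R^{\mathbf d},\ \omega\in\Omega,$$ and assume for all $\omega\in\Omega$ that $$\mathbf k(\omega)\in\operatorname*{arg\,min}_{(k,n)\in\{1,\dots,K\}\times\mathfrak N,\ \|\Theta_{k,n}(\omega)\|_\infty\le\beta}\mathcal R(\Theta_{k,n}(\omega),\omega).$$ Then all integrals on the left-hand side of the following inequality are well defined and finite, and $$\left(\mathbb E\left[\left(\int_{[a,b]}\bigl|\mathscr N^{\Theta_{\mathbf k},\mathbf l}_{u,v}(x)-\mathcal E(x)\bigr|^2\,\mathbb P_{X_1}(\mathrm dx)\right)^{p}\right]\right)^{1/p}$$ $$\le\frac{L^2(b-a)^2}{A^2}+\frac{4(v-u)\,\mathbf L\,(\|\mathbf l\|_\infty+1)^{\mathbf L}\,c^{\mathbf L+1}\max\{p,1\}}{K^{\mathbf L^{-1}(\|\mathbf l\|_\infty+1)^{-2}}}+\frac{10\,(\max\{v-u,1\})^2\,\mathbf L\,(\|\mathbf l\|_\infty+1)^{3/2}\max\{p,\ln(4M\beta c)\}}{\sqrt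 M}.$$ -/

import Mathlib

open MeasureTheory ProbabilityTheory

noncomputable section

namespace ReluNet

/-- The `k`-th entry (counted from `0`) of a parameter vector; entries beyond the length of the
vector are read as `0`, which never happens if the vector is long enough for the architecture. -/
def entry {d : ℕ} (θ : Fin d → ℝ) (k : ℕ) : ℝ := if h : k < d then θ ⟨k, h⟩ else 0

/-- The affine function from `ℝ^n` to `ℝ^m` whose weight matrix (row by row) and then bias vector
are read off from the entries of `θ` after the first `s` ones. -/
def affine {d : ℕ} (m n : ℕ) (θ : Fin d → ℝ) (s : ℕ) (x : Fin n → ℝ) : Fin m → ℝ := fun i =>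
  (∑ j : Fin n, entry θ (s + (i : ℕ) * n + (j : ℕ)) * x j) + entry θ (s + m * n + (i : ℕ))

/-- Number of parameters of the first `k` layers. Here and below an architecture
`(l 0, ..., l L)` is given by a function `l` on `ℕ`, of which only `l 0, ..., l L` are used. -/
def paramCount (l : ℕ → ℕ) (k : ℕ) : ℕ := ∑ i ∈ Finset.range k, l (i + 1) * (l i + 1)

/-- Output of layer `k` of the fully connected feedforward network with layer dimensions `l`,
activation function `act k` after the `k`-th affine function, and parameters read from `θ`
starting after the first `s` entries. -/
def network {d : ℕ} (l : ℕ → ℕ) (act : (k : ℕ) → (Fin (l k) → ℝ) → (Fin (l k) → ℝ))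
    (θ : Fin d → ℝ) (s : ℕ) (x : Fin (l 0) → ℝ) : (k : ℕ) → (Fin (l k) → ℝ)
  | 0 => x
  | k + 1 => act (k + 1)
      (affine (l (k + 1)) (l k) θ (s + paramCount l k) (network l act θ s x k))

/-- Rectifier (ReLU) function. -/
def rect (x : ℝ) : ℝ := max x 0

/-- Clipping to `[u, v]`. -/
def clip (u v x : ℝ) : ℝ := max (min x v) u

/-- The rectified clipped network with architecture `(l 0, ..., l L)`: componentwise rectifiers
after the layers `1, ..., L - 1` and componentwise clipping after layer `L`. -/
def clippedDNN {d : ℕ} (L : ℕ) (l : ℕ → ℕ) (u v : ℝ) (θ : Fin d → ℝ) (x : Fin (l 0) → ℝ) :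
    Fin (l L) → ℝ :=
  network l (fun k y i => if k = L then clip u v (y i) else rect (y i)) θ 0 x L

/-- The rectified clipped network as a function from `ℝ` to `ℝ`
when `l 0 = 1` and `l L = 1` (identifying `ℝ^1` with `ℝ`). -/
def realDNN {d : ℕ} (L : ℕ) (l : ℕ → ℕ) (_h0 : l 0 = 1) (hL : l L = 1) (u v : ℝ)
    (θ : Fin d → ℝ) (x : ℝ) : ℝ :=
  clippedDNN L l u v θ (fun _ => x) ⟨0, by omega⟩

/-- The maximal layer dimension, i.e. the maximum norm of `(l 0, ..., l L)`. -/
def maxDim (L : ℕ) (l : ℕ → ℕ) : ℕ := (Finset.range (L + 1)).sup l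

/-- Mean squared error of `f` on the sample `(x j, y j)`. -/
def empiricalRisk {M : ℕ} (f : ℝ → ℝ) (x y : Fin M → ℝ) : ℝ :=
  (1 / (M : ℝ)) * ∑ j, |f (x j) - y j| ^ 2

/-- Squared `L²`-distance on `[a, b]` between `f` and `g` with respect to `μ`. -/
def sqError (a b : ℝ) (μ : Measure ℝ) (f g : ℝ → ℝ) : ℝ :=
  ∫ x in Set.Icc a b, |f x - g x| ^ 2 ∂μ

end ReluNet

end

namespace ReluNet

/-! Since `E` is the regression function, the squared `L²`-error of a network equals its risk minus
the risk of `E` (`risk_eq_add`). Hence for any fixed reference vector `ϑ` the error of the selected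
network is the error of `ϑ` plus a difference of risks. Let `G` bound the gap between empirical and
true risk uniformly over the parameters of size at most `β`. Passing to empirical risks costs `2 *
G`, and by minimality the selected vector can then be exchanged for any admissible starting point.
So the error is at most the sum of three terms.

Approximation: `ϑ` realises a piecewise linear interpolant of `E` with `l 1` pieces, carried through
the deeper layers by `g = rect g - rect (-g)` (`exists_realDNN_close`).

Optimisation: the empirical risk is Lipschitz in the parameters with a constant not depending on the
data, so it suffices that some starting point is near `ϑ`. Only the first `n = paramCount l L`
coordinates matter. A uniform point is within `2 * c * t` of `ϑ` there with probability at least `t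
^ n`, so the best of `K` points misses with probability at most `exp (-K * t ^ n)`, which gives the
rate `K ^ (-1 / n)` (`eLpNorm_inf_entryDist_le`), and `n` is at most depth times squared width.

Generalisation: Hoeffding's lemma at the points of a finite parameter grid, a moment bound for the
maximum, and Lipschitz continuity off the grid (`exists_generalization_bound`). The mesh enters only
through a logarithm, and so does `β`.

The last bound is uniform in the parameters and the Lipschitz bound is uniform in the data, so no
independence between data and starting points is needed. -/

/-! ### Size, Lipschitz dependence on parameters, and continuity of networks -/

lemma weight_index_lt (l : ℕ → ℕ) {k i j : ℕ} (hi : i < l (k + 1)) (hj : j < l k) :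
    paramCount l k + i * l k + j < paramCount l (k + 1) := by
  have h1 : (i + 1) * l k ≤ l (k + 1) * l k := Nat.mul_le_mul_right _ hi
  have h2 : paramCount l (k + 1) = paramCount l k + l (k + 1) * (l k + 1) := by
    simp [paramCount, Finset.sum_range_succ]
  rw [h2]
  nlinarith

lemma bias_index_lt (l : ℕ → ℕ) {k i : ℕ} (hi : i < l (k + 1)) :
    paramCount l k + l (k + 1) * l k + i < paramCount l (k + 1) := by
  have h2 : paramCount l (k + 1) = paramCount l k + l (k + 1) * (l k + 1) := by
    simp [paramCount, Finset.sum_range_succ]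
  rw [h2]
  nlinarith

lemma paramCount_mono (l : ℕ → ℕ) : Monotone (paramCount l) := fun _ _ h =>
  Finset.sum_le_sum_of_subset (Finset.range_mono h)

/-- The `l k` weights contribute `l k * B * r`; the bias, at most `B`, is absorbed into one more
summand `B * r` because `1 ≤ r`. -/
lemma affine_abs_le {d : ℕ} {l : ℕ → ℕ} {k : ℕ} {θ : Fin d → ℝ} {B r w : ℝ} (hr : 1 ≤ r)
    (hB : 0 ≤ B) (hw : (l k : ℝ) + 1 ≤ w) (hθ : ∀ j < paramCount l (k + 1), |entry θ j| ≤ B)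
    {y : Fin (l k) → ℝ} (hy : ∀ j, |y j| ≤ r) (i : Fin (l (k + 1))) :
    |affine (l (k + 1)) (l k) θ (paramCount l k) y i| ≤ w * B * r := by
  have h1 : |∑ j : Fin (l k), entry θ (paramCount l k + i * l k + j) * y j| ≤ l k * (B * r) := by
    refine (Finset.abs_sum_le_sum_abs _ _).trans ?_
    refine (Finset.sum_le_card_nsmul _ _ (B * r) fun j _ => ?_).trans_eq (by simp)
    rw [abs_mul]
    exact mul_le_mul (hθ _ (weight_index_lt l i.2 j.2)) (hy j) (abs_nonneg _) hB
  have h2 := hθ _ (bias_index_lt l i.2)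
  have h3 : B * 1 ≤ B * r := mul_le_mul_of_nonneg_left hr hB
  have h4 : (0:ℝ) ≤ B * r := by nlinarith
  have h5 := mul_le_mul_of_nonneg_right hw h4
  unfold affine
  refine (abs_add_le _ _).trans ?_
  nlinarith

lemma affine_sub_abs_le {d d' : ℕ} {l : ℕ → ℕ} {k : ℕ} {θ : Fin d → ℝ} {θ' : Fin d' → ℝ}
    {B r w δ ε : ℝ} (hr : 1 ≤ r) (hB : 0 ≤ B) (hw : (l k : ℝ) + 1 ≤ w) (hδ : 0 ≤ δ) (hε : 0 ≤ ε)
    (hθ' : ∀ j < paramCount l (k + 1), |entry θ' j| ≤ B)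
    (hθθ' : ∀ j < paramCount l (k + 1), |entry θ j - entry θ' j| ≤ δ)
    {y y' : Fin (l k) → ℝ} (hy : ∀ j, |y j| ≤ r) (hyy' : ∀ j, |y j - y' j| ≤ ε)
    (i : Fin (l (k + 1))) :
    |affine (l (k + 1)) (l k) θ (paramCount l k) y i
      - affine (l (k + 1)) (l k) θ' (paramCount l k) y' i| ≤ w * r * δ + w * B * ε := by
  have h1 : |∑ j : Fin (l k), (entry θ (paramCount l k + i * l k + j) * y j
      - entry θ' (paramCount l k + i * l k + j) * y' j)| ≤ l k * (δ * r + B * ε) := by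
    refine (Finset.abs_sum_le_sum_abs _ _).trans ?_
    refine (Finset.sum_le_card_nsmul _ _ (δ * r + B * ε) fun j _ => ?_).trans_eq
      (by rw [Finset.card_univ, Fintype.card_fin, nsmul_eq_mul])
    have e : entry θ (paramCount l k + i * l k + j) * y j
        - entry θ' (paramCount l k + i * l k + j) * y' j
        = (entry θ (paramCount l k + i * l k + j) - entry θ' (paramCount l k + i * l k + j)) * y j
          + entry θ' (paramCount l k + i * l k + j) * (y j - y' j) := by ring
    rw [e]
    refine (abs_add_le _ _).trans ?_
    rw [abs_mul, abs_mul]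
    exact add_le_add
      (mul_le_mul (hθθ' _ (weight_index_lt l i.2 j.2)) (hy j) (abs_nonneg _) hδ)
      (mul_le_mul (hθ' _ (weight_index_lt l i.2 j.2)) (hyy' j) (abs_nonneg _) hB)
  have h2 := hθθ' _ (bias_index_lt l i.2)
  have h3 : δ * 1 ≤ δ * r := mul_le_mul_of_nonneg_left hr hδ
  have h4 : (0:ℝ) ≤ δ * r := by nlinarith
  have h6 : (0:ℝ) ≤ B * ε := by positivity
  have h5 := mul_le_mul_of_nonneg_right hw h4
  have h7 := mul_le_mul_of_nonneg_right hw h6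
  have e : affine (l (k + 1)) (l k) θ (paramCount l k) y i
      - affine (l (k + 1)) (l k) θ' (paramCount l k) y' i
      = (∑ j : Fin (l k), (entry θ (paramCount l k + i * l k + j) * y j
      - entry θ' (paramCount l k + i * l k + j) * y' j))
      + (entry θ (paramCount l k + l (k + 1) * l k + i)
        - entry θ' (paramCount l k + l (k + 1) * l k + i)) := by
    rw [Finset.sum_sub_distrib]
    unfold affine
    ring
  rw [e]
  refine (abs_add_le _ _).trans ?_
  nlinarith

lemma network_abs_le {d : ℕ} {l : ℕ → ℕ} {act : (k : ℕ) → (Fin (l k) → ℝ) → (Fin (l k) → ℝ)}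
    {θ : Fin d → ℝ} {B r w : ℝ} (hr : 1 ≤ r) (hB : 1 ≤ B) {x : Fin (l 0) → ℝ}
    (hx : ∀ i, |x i| ≤ r) (k : ℕ) (hw : ∀ j ≤ k, (l j : ℝ) + 1 ≤ w)
    (hact : ∀ j ≤ k, ∀ y i, |act j y i| ≤ |y i|)
    (hθ : ∀ j < paramCount l k, |entry θ j| ≤ B) (i : Fin (l k)) :
    |network l act θ 0 x k i| ≤ (w * B) ^ k * r := by
  induction k with
  | zero => simpa [network] using hx i
  | succ k ih =>
    have hw1 : 1 ≤ w := le_trans (by simp) (hw 0 (Nat.zero_le _))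
    have hwB : 1 ≤ w * B := by nlinarith
    have hp : 1 ≤ (w * B) ^ k * r := by
      have := one_le_pow₀ hwB (n := k)
      nlinarith
    have ih' := ih (fun j hj => hw j (by omega)) (fun j hj => hact j (by omega))
      (fun j hj => hθ j (hj.trans_le (paramCount_mono l (Nat.le_succ k))))
    simp only [network, Nat.zero_add]
    refine (hact _ le_rfl _ _).trans ?_
    refine (affine_abs_le hp (by linarith) (hw k (by omega)) hθ ih' i).trans_eq ?_
    ring

/-- Each new layer multiplies the old deviation by `w * B` and adds `w * δ` times the size `(w * B)
^ k * r` of its input. All layers thus end up contributing the same amount, whence the factor `k`.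
The growth bound `hact` is asked only below the last layer, since clipping can increase absolute
values. -/
lemma network_sub_abs_le {d d' : ℕ} {l : ℕ → ℕ}
    {act : (k : ℕ) → (Fin (l k) → ℝ) → (Fin (l k) → ℝ)}
    {θ : Fin d → ℝ} {θ' : Fin d' → ℝ} {B r w δ : ℝ} (hr : 1 ≤ r) (hB : 1 ≤ B) (hδ : 0 ≤ δ)
    {x : Fin (l 0) → ℝ} (hx : ∀ i, |x i| ≤ r) (k : ℕ) (hw : ∀ j ≤ k, (l j : ℝ) + 1 ≤ w)
    (hact : ∀ j < k, ∀ y i, |act j y i| ≤ |y i|)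
    (hactlip : ∀ j ≤ k, ∀ y y' i, |act j y i - act j y' i| ≤ |y i - y' i|)
    (hθ : ∀ j < paramCount l k, |entry θ j| ≤ B)
    (hθ' : ∀ j < paramCount l k, |entry θ' j| ≤ B)
    (hθθ' : ∀ j < paramCount l k, |entry θ j - entry θ' j| ≤ δ) (i : Fin (l k)) :
    |network l act θ 0 x k i - network l act θ' 0 x k i| ≤ k * w ^ k * B ^ (k - 1) * r * δ := by
  induction k with
  | zero => simp [network]
  | succ k ih =>
    have hw1 : 1 ≤ w := le_trans (by simp) (hw 0 (Nat.zero_le _))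
    have hwB : 1 ≤ w * B := by nlinarith
    have hp : 1 ≤ (w * B) ^ k * r := by
      have := one_le_pow₀ hwB (n := k)
      nlinarith
    have hm : ∀ {j}, j < paramCount l k → j < paramCount l (k + 1) := fun hj =>
      hj.trans_le (paramCount_mono l (Nat.le_succ k))
    have ih' := ih (fun j hj => hw j (by omega)) (fun j hj => hact j (by omega))
      (fun j hj => hactlip j (by omega)) (fun j hj => hθ j (hm hj)) (fun j hj => hθ' j (hm hj))
      (fun j hj => hθθ' j (hm hj))
    simp only [network, Nat.zero_add]
    refine (hactlip _ le_rfl _ _ _).trans ?_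
    have hb := network_abs_le (act := act) (θ := θ) hr hB hx k (fun j hj => hw j (by omega))
      (fun j hj => hact j (by omega)) (fun j hj => hθ j (hm hj))
    refine (affine_sub_abs_le hp (by linarith) (hw k (by omega)) hδ (by positivity) hθ' hθθ' hb ih'
      i).trans_eq ?_
    -- The truncated exponent `k - 1` is wrong at `k = 0`, where the factor `k` annihilates the
    -- term.
    rcases k with _ | k
    · simp
    · simp only [Nat.add_sub_cancel]
      push_cast
      ring

lemma abs_clip_sub_clip_le (u v x y : ℝ) : |clip u v x - clip u v y| ≤ |x - y| := by
  unfold clip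
  refine (abs_max_sub_max_le_abs _ _ _).trans ?_
  exact abs_inf_sub_inf_le_abs _ _ _

lemma abs_rect_sub_rect_le (x y : ℝ) : |rect x - rect y| ≤ |x - y| :=
  abs_max_sub_max_le_abs _ _ _

lemma abs_rect_le (x : ℝ) : |rect x| ≤ |x| := by
  simpa [rect] using abs_rect_sub_rect_le x 0

lemma clip_mem_Icc {u v : ℝ} (huv : u ≤ v) (x : ℝ) : clip u v x ∈ Set.Icc u v :=
  ⟨le_max_right _ _, max_le (min_le_right _ _) huv⟩

lemma clip_eq_self {u v x : ℝ} (hx : x ∈ Set.Icc u v) : clip u v x = x := by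
  simp [clip, hx.1, hx.2]

lemma realDNN_mem_Icc {d L : ℕ} {l : ℕ → ℕ} (h0 : l 0 = 1) (hlL : l L = 1) (hL : 1 ≤ L) {u v : ℝ}
    (huv : u ≤ v) (θ : Fin d → ℝ) (x : ℝ) : realDNN L l h0 hlL u v θ x ∈ Set.Icc u v := by
  obtain ⟨L, rfl⟩ := Nat.exists_eq_add_of_le' hL
  simp only [realDNN, clippedDNN, network, if_true]
  exact clip_mem_Icc huv _

/-- The realisation depends Lipschitz continuously on the entries of the parameter vector. -/
lemma realDNN_sub_abs_le {d d' L : ℕ} {l : ℕ → ℕ} (h0 : l 0 = 1) (hlL : l L = 1) {u v : ℝ}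
    {θ : Fin d → ℝ} {θ' : Fin d' → ℝ} {B r w δ : ℝ} (hr : 1 ≤ r) (hB : 1 ≤ B) (hδ : 0 ≤ δ)
    {x : ℝ} (hx : |x| ≤ r) (hw : ∀ j ≤ L, (l j : ℝ) + 1 ≤ w)
    (hθ : ∀ j < paramCount l L, |entry θ j| ≤ B)
    (hθ' : ∀ j < paramCount l L, |entry θ' j| ≤ B)
    (hθθ' : ∀ j < paramCount l L, |entry θ j - entry θ' j| ≤ δ) :
    |realDNN L l h0 hlL u v θ x - realDNN L l h0 hlL u v θ' x|
      ≤ L * w ^ L * B ^ (L - 1) * r * δ := by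
  refine network_sub_abs_le hr hB hδ (fun _ => hx) L hw ?_ ?_ hθ hθ' hθθ' _
  · intro j hj y i
    simp only [hj.ne, if_false]
    exact abs_rect_le _
  · intro j _ y y' i
    split_ifs
    · exact abs_clip_sub_clip_le _ _ _ _
    · exact abs_rect_sub_rect_le _ _

lemma continuous_entry {d : ℕ} (k : ℕ) : Continuous fun θ : Fin d → ℝ => entry θ k := by
  unfold entry
  split_ifs
  · fun_prop
  · fun_prop

lemma continuous_realDNN {d L : ℕ} {l : ℕ → ℕ} (h0 : l 0 = 1) (hlL : l L = 1) (u v : ℝ) :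
    Continuous fun q : (Fin d → ℝ) × ℝ => realDNN L l h0 hlL u v q.1 q.2 := by
  have key : ∀ k, Continuous fun q : (Fin d → ℝ) × ℝ => network l
      (fun k y i => if k = L then clip u v (y i) else rect (y i)) q.1 0 (fun _ => q.2) k := by
    intro k
    induction k with
    | zero => simp only [network]; fun_prop
    | succ k ih =>
      have ha : Continuous fun q : (Fin d → ℝ) × ℝ =>
          affine (l (k + 1)) (l k) q.1 (0 + paramCount l k) (network l
            (fun k y i => if k = L then clip u v (y i) else rect (y i)) q.1 0 (fun _ => q.2) k) := by
        refine continuous_pi fun i => ?_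
        unfold affine
        refine Continuous.add (continuous_finsetSum _ fun j _ => ?_)
          ((continuous_entry _).comp continuous_fst)
        exact ((continuous_entry _).comp continuous_fst).mul ((continuous_apply j).comp ih)
      refine continuous_pi fun i => ?_
      have hai := (continuous_apply i).comp ha
      simp only [network]
      split_ifs
      · unfold clip; exact (hai.min continuous_const).max continuous_const
      · unfold rect; exact hai.max continuous_const
  exact (continuous_apply _).comp (key L)

/-! ### Approximation of Lipschitz functions by networks -/

lemma paramCount_succ (l : ℕ → ℕ) (k : ℕ) :
    paramCount l (k + 1) = paramCount l k + l (k + 1) * (l k + 1) := by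
  simp [paramCount, Finset.sum_range_succ]

/-- Weight matrices and bias vectors can be stored in one parameter sequence. -/
lemma exists_entries (l : ℕ → ℕ) {c : ℝ} (hc : 0 ≤ c) (W : ℕ → ℕ → ℕ → ℝ) (b : ℕ → ℕ → ℝ)
    (hW : ∀ k i j, |W k i j| ≤ c) (hb : ∀ k i, |b k i| ≤ c) (n : ℕ) :
    ∃ e : ℕ → ℝ, (∀ m, |e m| ≤ c) ∧ ∀ k < n, ∀ i < l (k + 1),
      (∀ j < l k, e (paramCount l k + i * l k + j) = W k i j) ∧
      e (paramCount l k + l (k + 1) * l k + i) = b k i := by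
  induction n with
  | zero => exact ⟨fun _ => 0, by simpa using hc, by simp⟩
  | succ n ih =>
    obtain ⟨e, he, h⟩ := ih
    -- Earlier layers keep their entries; in the new block, row and column of a weight are recovered
    -- as quotient and remainder modulo `l n`, and the biases follow.
    refine ⟨fun m => if m < paramCount l n then e m else
      if m < paramCount l n + l (n + 1) * l n then
        W n ((m - paramCount l n) / l n) ((m - paramCount l n) % l n) else
        b n (m - (paramCount l n + l (n + 1) * l n)), ?_, ?_⟩
    · intro m
      dsimp only
      split_ifs
      exacts [he m, hW _ _ _, hb _ _]
    · intro k hk i hi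
      rcases Nat.lt_succ_iff_lt_or_eq.1 hk with hk | rfl
      · have hm : paramCount l (k + 1) ≤ paramCount l n := paramCount_mono l hk
        refine ⟨fun j hj => ?_, ?_⟩
        · have := weight_index_lt l hi hj
          dsimp only
          rw [if_pos (by omega)]
          exact (h k hk i hi).1 j hj
        · have := bias_index_lt l hi
          dsimp only
          rw [if_pos (by omega)]
          exact (h k hk i hi).2
      · refine ⟨fun j hj => ?_, ?_⟩
        · have h1 : (i + 1) * l k ≤ l (k + 1) * l k := Nat.mul_le_mul_right _ hi
          have h2 : i * l k + j < l (k + 1) * l k := by nlinarith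
          dsimp only
          rw [if_neg (by omega), if_pos (by omega)]
          have h3 : paramCount l k + i * l k + j - paramCount l k = j + l k * i := by
            rw [mul_comm]; omega
          rw [h3, Nat.add_mul_div_left _ _ (by omega), Nat.add_mul_mod_self_left,
            Nat.div_eq_of_lt hj, Nat.mod_eq_of_lt hj, Nat.zero_add]
        · dsimp only
          rw [if_neg (by omega), if_neg (by omega)]
          congr 1
          omega

lemma rect_sub_rect_neg (x : ℝ) : rect x - rect (-x) = x := by
  unfold rect
  rcases le_total 0 x with h | h
  · rw [max_eq_left h, max_eq_right (by linarith)]; ring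
  · rw [max_eq_right h, max_eq_left (by linarith)]; ring

/-- A one-hidden-layer rectified function can be realised by any deeper architecture with at least
two neurons in every further hidden layer. -/
lemma exists_realDNN_eq {d L : ℕ} {l : ℕ → ℕ} (h0 : l 0 = 1) (hlL : l L = 1) (hL : 2 ≤ L)
    (hd : paramCount l L ≤ d) (hl : ∀ i, 2 ≤ i → i ≤ L - 1 → 2 ≤ l i) {c : ℝ} (hc : 1 ≤ c)
    (t s : ℕ → ℝ) (f₀ : ℝ) (ht : ∀ j, |t j| ≤ c) (hs : ∀ j, |s j| ≤ c) (hf₀ : |f₀| ≤ c)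
    (u v : ℝ) :
    ∃ θ : Fin d → ℝ, (∀ i, |θ i| ≤ c) ∧ ∀ x, realDNN L l h0 hlL u v θ x
      = clip u v ((∑ j ∈ Finset.range (l 1), s j * rect (x - t j)) + f₀) := by
  have hsgn : ∀ i : ℕ, |(if i = 0 then (1:ℝ) else if i = 1 then -1 else 0)| ≤ 1 := by
    intro i; split_ifs <;> simp
  -- Signs `1, -1, 0, 0, ...`: from layer 2 on, neuron `i` has preactivation `σ i * g`. After
  -- rectification the first two neurons hold `rect g` and `rect (-g)`, and their signed sum
  -- restores `g`; surplus neurons are switched off.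
  set σ : ℕ → ℝ := fun i => if i = 0 then (1:ℝ) else if i = 1 then -1 else 0 with hσ
  have hmul : ∀ i y, |y| ≤ c → |σ i * y| ≤ c := by
    intro i y hy
    rw [abs_mul]
    have := mul_le_mul (hsgn i) hy (abs_nonneg _) zero_le_one
    linarith
  obtain ⟨e, he, h⟩ := exists_entries l (zero_le_one.trans hc)
    (fun k i j => if k = 0 then 1 else if k = 1 then σ i * s j else σ i * σ j)
    (fun k i => if k = 0 then -t i else if k = 1 then σ i * f₀ else 0)
    (by
      intro k i j
      split_ifs
      · simpa using hc
      · exact hmul _ _ (hs j)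
      · exact hmul _ _ ((hsgn j).trans hc))
    (by
      intro k i
      split_ifs
      · simpa using ht i
      · exact hmul _ _ hf₀
      · simpa using zero_le_one.trans hc) L
  refine ⟨fun i => e i, fun i => he i, fun x => ?_⟩
  set θ : Fin d → ℝ := fun i => e i with hθ
  have hentry : ∀ m < paramCount l L, entry θ m = e m := by
    intro m hm
    simp [entry, hθ, hm.trans_le hd]
  have haff : ∀ k < L, ∀ y : Fin (l k) → ℝ, ∀ i : Fin (l (k + 1)),
      affine (l (k + 1)) (l k) θ (0 + paramCount l k) y i
        = (∑ j : Fin (l k), (if k = 0 then 1 else if k = 1 then σ i * s j else σ i * σ j) * y j)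
          + if k = 0 then -t i else if k = 1 then σ i * f₀ else 0 := by
    intro k hk y i
    have hm := paramCount_mono l (Nat.succ_le_of_lt hk)
    unfold affine
    rw [Nat.zero_add, hentry _ ((bias_index_lt l i.2).trans_le hm), (h k hk i i.2).2]
    congr 1
    refine Finset.sum_congr rfl fun j _ => ?_
    rw [hentry _ ((weight_index_lt l i.2 j.2).trans_le hm), (h k hk i i.2).1 j j.2]
  set g : ℝ := (∑ j ∈ Finset.range (l 1), s j * rect (x - t j)) + f₀ with hg
  set N := network l (fun k y i => if k = L then clip u v (y i) else rect (y i)) θ 0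
    (fun _ => x) with hN
  have key : ∀ k, k + 1 < L → ∀ i : Fin (l (k + 2)),
      affine (l (k + 2)) (l (k + 1)) θ (0 + paramCount l (k + 1)) (N (k + 1)) i = σ i * g := by
    intro k
    induction k with
    | zero =>
      intro hk i
      rw [haff 1 hk]
      have hN1 : ∀ j : Fin (l 1), N 1 j = rect (x - t j) := by
        intro j
        have hcard : ∀ q : ℝ, ∑ _j : Fin (l 0), q = q := by simp [h0]
        simp only [hN, network, Nat.zero_add]
        rw [if_neg (by omega)]
        have := haff 0 (by omega) (fun _ => x) j
        simp only [Nat.zero_add, if_true, one_mul, hcard] at this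
        rw [this, sub_eq_add_neg]
      simp only [one_ne_zero, if_false, if_true, hN1]
      rw [hg, mul_add, Finset.mul_sum, ← Fin.sum_univ_eq_sum_range
        (fun j => σ i * (s j * rect (x - t j)))]
      simp only [mul_assoc]
    | succ k ih =>
      intro hk i
      rw [haff (k + 2) (by omega)]
      have ih' := ih (by omega)
      have h2 : 2 ≤ l (k + 2) := hl _ (by omega) (by omega)
      have hNk : ∀ j : Fin (l (k + 2)), N (k + 2) j = rect (σ j * g) := by
        intro j
        rw [← ih' j]
        simp only [hN, network]
        rw [if_neg (by omega)]
      simp only [hNk]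
      have e1 : ∀ j : Fin (l (k + 2)), (if k + 2 = 0 then (1:ℝ) else if k + 2 = 1 then σ i * s j
          else σ i * σ j) * rect (σ j * g) = σ i * (σ j * rect (σ j * g)) := by
        intro j
        rw [if_neg (by omega), if_neg (by omega), mul_assoc]
      have e2 : ∑ j : Fin (l (k + 2)), σ j * rect (σ j * g) = g := by
        rw [Fin.sum_univ_eq_sum_range (fun j => σ j * rect (σ j * g))]
        generalize l (k + 2) = n at h2
        obtain ⟨m, rfl⟩ := Nat.exists_eq_add_of_le h2
        rw [Finset.sum_range_add, Finset.sum_range_succ, Finset.sum_range_one,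
          Finset.sum_eq_zero (s := Finset.range m)]
        · simp only [hσ]
          simpa [sub_eq_add_neg] using rect_sub_rect_neg g
        · intro j _
          simp [hσ, show 2 + j ≠ 1 by omega]
      refine (congrArg₂ (· + ·) (Finset.sum_congr rfl fun j _ => e1 j)
        (show _ = (0:ℝ) by rw [if_neg (by omega), if_neg (by omega)])).trans ?_
      rw [← Finset.mul_sum, e2, add_zero]
  obtain ⟨k, rfl⟩ := Nat.exists_eq_add_of_le' hL
  simp only [realDNN, clippedDNN]
  have := key k (by omega) ⟨0, by omega⟩
  rw [hN] at this
  simp only [network, if_true]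
  simp only [network] at this
  rw [this]
  simp [hσ]

/-- Piecewise linear interpolation of a Lipschitz function, written with rectifiers. -/
lemma exists_rect_sum_close {n : ℕ} (hn : 0 < n) {a b Lip : ℝ} (hab : a < b) (hLip : 0 ≤ Lip)
    {f : ℝ → ℝ}
    (hf : ∀ x ∈ Set.Icc a b, ∀ y ∈ Set.Icc a b, |f x - f y| ≤ Lip * |x - y|) :
    ∃ t s : ℕ → ℝ, (∀ j, t j ∈ Set.Icc a b) ∧ (∀ j, |s j| ≤ 2 * Lip) ∧ ∀ x ∈ Set.Icc a b,
      |(∑ j ∈ Finset.range n, s j * rect (x - t j)) + f a - f x| ≤ Lip * ((b - a) / n) := by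
  set h : ℝ := (b - a) / n with hh
  have hn' : (0:ℝ) < n := by exact_mod_cast hn
  have hpos : 0 < h := div_pos (by linarith) hn'
  have hnh : n * h = b - a := by rw [hh]; field_simp
  set z : ℕ → ℝ := fun j => a + j * h with hz
  have hzmem : ∀ j ≤ n, z j ∈ Set.Icc a b := by
    intro j hj
    have : (j:ℝ) ≤ n := by exact_mod_cast hj
    constructor
    · simp only [hz]; nlinarith [(Nat.cast_nonneg j : (0:ℝ) ≤ j)]
    · simp only [hz]; nlinarith
  have hzs : ∀ j, z (j + 1) = z j + h := by intro j; simp only [hz]; push_cast; ring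
  set m : ℕ → ℝ := fun j => (f (z (j + 1)) - f (z j)) / h with hm
  have hmabs : ∀ j < n, |m j| ≤ Lip := by
    intro j hj
    simp only [hm]
    rw [abs_div, abs_of_pos hpos, div_le_iff₀ hpos]
    refine (hf _ (hzmem _ hj) _ (hzmem _ hj.le)).trans_eq ?_
    rw [hzs, add_sub_cancel_left, abs_of_pos hpos]
  -- The coefficient of a rectifier is the change of slope at its knot, hence a difference of two
  -- chord slopes of size at most `Lip`.
  set s : ℕ → ℝ := fun j => if j < n then (if j = 0 then m 0 else m j - m (j - 1)) else 0 with hs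
  -- The value `a` beyond `n` is never used; it only keeps every `t j` in the interval.
  refine ⟨fun j => if j ≤ n then z j else a, s, ?_, ?_, ?_⟩
  · intro j
    dsimp only
    split_ifs with hj
    · exact hzmem j hj
    · exact ⟨le_rfl, hab.le⟩
  · intro j
    simp only [hs]
    split_ifs with h1 h2
    · have := hmabs 0 hn; linarith
    · have h3 := hmabs j h1
      have h4 := hmabs (j - 1) (by omega)
      exact (abs_sub _ _).trans (by linarith)
    · simpa using hLip
  · intro x hx
    -- The slope changes telescope: the first `k + 1` terms add up to the chord of `f` on the `k`-th
    -- subinterval.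
    have hsum : ∀ k, k < n → ∑ j ∈ Finset.range (k + 1), s j * (x - z j) + f a
        = f (z k) + m k * (x - z k) := by
      intro k
      induction k with
      | zero =>
        intro _
        have : z 0 = a := by simp [hz]
        simp [hs, hn, this]
        ring
      | succ k ih =>
        intro hk
        rw [Finset.sum_range_succ, add_right_comm, ih (by omega)]
        have e1 : s (k + 1) = m (k + 1) - m k := by simp [hs, hk]
        have e2 : f (z (k + 1)) = f (z k) + m k * h := by
          simp only [hm]; field_simp; ring
        rw [e1, e2, hzs]
        ring
    obtain ⟨k, hk, hk1, hk2⟩ : ∃ k, k < n ∧ z k ≤ x ∧ x ≤ z (k + 1) := by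
      -- At `x = b` the floor below would give `n`, which is not the index of a subinterval.
      rcases eq_or_lt_of_le hx.2 with hxb | hxb
      · refine ⟨n - 1, by omega, ?_, ?_⟩
        · rw [hxb]; exact (hzmem _ (by omega)).2
        · rw [hxb, Nat.sub_add_cancel hn]; simp only [hz]; linarith
      · have hq : 0 ≤ (x - a) / h := div_nonneg (by linarith [hx.1]) hpos.le
        refine ⟨⌊(x - a) / h⌋₊, ?_, ?_, ?_⟩
        · rw [Nat.floor_lt hq, div_lt_iff₀ hpos]; linarith
        · have := Nat.floor_le hq
          rw [le_div_iff₀ hpos] at this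
          simp only [hz]; linarith
        · have := (Nat.lt_floor_add_one ((x - a) / h)).le
          rw [div_le_iff₀ hpos] at this
          simp only [hz]; push_cast; linarith
    have hzmono : ∀ i j, i ≤ j → z i ≤ z j := by
      intro i j hij
      have : (i:ℝ) ≤ j := by exact_mod_cast hij
      simp only [hz]; nlinarith
    have hfull : ∑ j ∈ Finset.range n, s j * rect (x - if j ≤ n then z j else a)
        = ∑ j ∈ Finset.range (k + 1), s j * (x - z j) := by
      rw [← Finset.sum_subset (Finset.range_mono (Nat.succ_le_of_lt hk))]
      · refine Finset.sum_congr rfl fun j hj => ?_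
        have hj' := Finset.mem_range.1 hj
        rw [if_pos (by omega), rect, max_eq_left]
        have := hzmono j k (by omega)
        linarith
      · intro j hj hj'
        simp only [Finset.mem_range] at hj hj'
        rw [if_pos hj.le, rect, max_eq_right, mul_zero]
        have := hzmono (k + 1) j (by omega)
        linarith
    rw [hfull, hsum k hk]
    have hzk := hzs k
    -- The interpolation error is a convex combination of the deviations of `f x` from the two
    -- neighbouring knot values, each at most `Lip * h`.
    have e : f (z k) + m k * (x - z k) - f x
        = (1 - (x - z k) / h) * (f (z k) - f x) + (x - z k) / h * (f (z (k + 1)) - f x) := by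
      simp only [hm]; field_simp; ring
    have hq0 : 0 ≤ (x - z k) / h := div_nonneg (by linarith) hpos.le
    have hq1 : (x - z k) / h ≤ 1 := by rw [div_le_one hpos]; linarith
    have b1 : |f (z k) - f x| ≤ Lip * h := by
      refine (hf _ (hzmem _ hk.le) _ hx).trans (mul_le_mul_of_nonneg_left ?_ hLip)
      rw [abs_le]; constructor <;> linarith
    have b2 : |f (z (k + 1)) - f x| ≤ Lip * h := by
      refine (hf _ (hzmem _ hk) _ hx).trans (mul_le_mul_of_nonneg_left ?_ hLip)
      rw [abs_le]; constructor <;> linarith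
    rw [e]
    refine (abs_add_le _ _).trans ?_
    rw [abs_mul, abs_mul, abs_of_nonneg hq0, abs_of_nonneg (sub_nonneg.2 hq1)]
    have := mul_le_mul_of_nonneg_left b1 (sub_nonneg.2 hq1)
    have := mul_le_mul_of_nonneg_left b2 hq0
    linarith

/-- Approximation error of rectified clipped networks for Lipschitz functions on an interval. -/
lemma exists_realDNN_close {d L : ℕ} {l : ℕ → ℕ} (h0 : l 0 = 1) (hlL : l L = 1) (hL : 2 ≤ L)
    (hl1 : 0 < l 1) (hd : paramCount l L ≤ d) (hl : ∀ i, 2 ≤ i → i ≤ L - 1 → 2 ≤ l i)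
    {a b u v c Lip : ℝ} (hab : a < b) (hLip : 0 ≤ Lip)
    (hc : 1 ≤ c ∧ |u| ≤ c ∧ |v| ≤ c ∧ |a| ≤ c ∧ |b| ≤ c ∧ 2 * Lip ≤ c)
    {f : ℝ → ℝ} (hfmem : ∀ x ∈ Set.Icc a b, f x ∈ Set.Icc u v)
    (hf : ∀ x ∈ Set.Icc a b, ∀ y ∈ Set.Icc a b, |f x - f y| ≤ Lip * |x - y|) :
    ∃ θ : Fin d → ℝ, (∀ i, |θ i| ≤ c) ∧ ∀ x ∈ Set.Icc a b,
      |realDNN L l h0 hlL u v θ x - f x| ≤ Lip * ((b - a) / l 1) := by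
  obtain ⟨hc1, hcu, hcv, hca, hcb, hcL⟩ := hc
  obtain ⟨t, s, ht, hs, hts⟩ := exists_rect_sum_close hl1 hab hLip hf
  have habs : ∀ {y z w : ℝ}, |y| ≤ c → |z| ≤ c → w ∈ Set.Icc y z → |w| ≤ c := by
    intro y z w hy hz hw
    rw [abs_le] at *
    constructor <;> linarith [hw.1, hw.2]
  obtain ⟨θ, hθ, hθx⟩ := exists_realDNN_eq h0 hlL hL hd hl hc1 t s (f a)
    (fun j => habs hca hcb (ht j)) (fun j => (hs j).trans hcL)
    (habs hcu hcv (hfmem a ⟨le_rfl, hab.le⟩)) u v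
  refine ⟨θ, hθ, fun x hx => ?_⟩
  -- As `f` already takes values in `[u, v]`, clipping cannot increase the distance to it.
  rw [hθx, ← clip_eq_self (hfmem x hx)]
  refine (abs_clip_sub_clip_le _ _ _ _).trans ?_
  exact hts x hx

/-! ### Gamma function bounds and moments from tails -/

/-- Convexity on `[1, 2]`, with the value 1 at both endpoints. -/
lemma Gamma_add_one_le_one {x : ℝ} (h0 : 0 ≤ x) (h1 : x ≤ 1) : Real.Gamma (x + 1) ≤ 1 := by
  have h := Real.convexOn_Gamma.2 (x := 1) (y := 2) (by simp) (by simp) (sub_nonneg.2 h1) h0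
    (by ring)
  simp only [smul_eq_mul, Real.Gamma_one, Real.Gamma_two] at h
  rw [show (1 - x) * 1 + x * 2 = x + 1 by ring] at h
  linarith

/-- By the functional equation it suffices that `Γ(y) ≤ y ^ (y - 1)`. For `y ≤ 2` this is the
convexity bound, and beyond that it follows from the claim at `y - 1`, by induction over unit
intervals. -/
lemma Gamma_add_one_le_rpow_self {x : ℝ} (hx : 1 ≤ x) : Real.Gamma (x + 1) ≤ x ^ x := by
  have key : ∀ n : ℕ, ∀ y : ℝ, 1 ≤ y → y ≤ n + 1 → Real.Gamma (y + 1) ≤ y ^ y := by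
    intro n
    induction n with
    | zero =>
      intro y h1 h2
      obtain rfl : y = 1 := le_antisymm (by simpa using h2) h1
      simpa using Gamma_add_one_le_one zero_le_one le_rfl
    | succ n ih =>
      intro y h1 h2
      have hy : 0 < y := by linarith
      push_cast at h2
      have hG : Real.Gamma y ≤ y ^ (y - 1) := by
        rcases le_total y 2 with hy2 | hy2
        · have := Gamma_add_one_le_one (x := y - 1) (by linarith) (by linarith)
          rw [sub_add_cancel] at this
          exact this.trans (Real.one_le_rpow h1 (by linarith))
        · have := ih (y - 1) (by linarith) (by linarith)
          rw [sub_add_cancel] at this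
          exact this.trans (Real.rpow_le_rpow (by linarith) (by linarith) (by linarith))
      rw [Real.Gamma_add_one hy.ne']
      refine (mul_le_mul_of_nonneg_left hG hy.le).trans_eq ?_
      rw [Real.rpow_sub_one hy.ne']
      field_simp
  obtain ⟨n, hn⟩ := exists_nat_ge x
  exact key n x hx (by linarith)

lemma Gamma_div_add_one_le {p s : ℝ} (hp : 1 ≤ p) (hs : 1 ≤ s) :
    Real.Gamma (p / s + 1) ≤ p ^ p := by
  have hps : p / s ≤ p := div_le_self (by linarith) hs
  have h1 : (1:ℝ) ≤ p ^ p := Real.one_le_rpow hp (by linarith)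
  rcases le_total (p / s) 1 with h | h
  · exact (Gamma_add_one_le_one (by positivity) h).trans h1
  · refine (Gamma_add_one_le_rpow_self h).trans ?_
    refine (Real.rpow_le_rpow (by linarith) hps (by linarith)).trans ?_
    exact Real.rpow_le_rpow_of_exponent_le hp hps

lemma eLpNorm_le_of_lintegral_rpow_le {Ω : Type*} [MeasurableSpace Ω] {P : Measure Ω}
    {f : Ω → ℝ} (hf : ∀ ω, 0 ≤ f ω) {p C : ℝ} (hp : 0 < p) (hC : 0 ≤ C)
    (h : ∫⁻ ω, ENNReal.ofReal (f ω ^ p) ∂P ≤ ENNReal.ofReal (C ^ p)) :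
    eLpNorm f (ENNReal.ofReal p) P ≤ ENNReal.ofReal C := by
  rw [eLpNorm_eq_lintegral_rpow_enorm_toReal (by simpa using hp) ENNReal.ofReal_ne_top,
    ENNReal.toReal_ofReal hp.le]
  have e : ∀ ω, ‖f ω‖ₑ ^ p = ENNReal.ofReal (f ω ^ p) := fun ω => by
    rw [Real.enorm_eq_ofReal (hf ω), ENNReal.ofReal_rpow_of_nonneg (hf ω) hp.le]
  simp only [e]
  refine (ENNReal.rpow_le_rpow h (by positivity)).trans_eq ?_
  rw [← ENNReal.ofReal_rpow_of_nonneg hC hp.le, ← ENNReal.rpow_mul, mul_one_div_cancel hp.ne',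
    ENNReal.rpow_one]

/-- Moments of a nonnegative random variable with Weibull-type tails. -/
lemma eLpNorm_le_of_tail_le {Ω : Type*} [MeasurableSpace Ω] {P : Measure Ω}
    {T : Ω → ℝ} (hT : Measurable T) (hT0 : ∀ ω, 0 ≤ T ω) {p s K : ℝ} (hp : 1 ≤ p)
    (hs : 1 ≤ s) (hK : 0 < K)
    (h : ∀ t, 0 < t → P {ω | t < T ω} ≤ ENNReal.ofReal (Real.exp (-K * t ^ s))) :
    eLpNorm T (ENNReal.ofReal p) P ≤ ENNReal.ofReal (p * K ^ (-(1 / s))) := by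
  have hp0 : 0 < p := by linarith
  have hs0 : 0 < s := by linarith
  refine eLpNorm_le_of_lintegral_rpow_le hT0 hp0 (by positivity) ?_
  rw [lintegral_rpow_eq_lintegral_meas_lt_mul P (ae_of_all _ hT0) hT.aemeasurable hp0]
  have hval := integral_rpow_mul_exp_neg_mul_rpow (p := s) (q := p - 1) (b := K) hs0
    (by linarith) hK
  have hpos : 0 < K ^ (-(p - 1 + 1) / s) * (1 / s) * Real.Gamma ((p - 1 + 1) / s) := by
    have : 0 < Real.Gamma ((p - 1 + 1) / s) := Real.Gamma_pos_of_pos (by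
      rw [sub_add_cancel]; positivity)
    positivity
  -- A non-integrable function would have Bochner integral 0, whereas the Gamma integral is
  -- positive.
  have hI : Integrable (fun x : ℝ => x ^ (p - 1) * Real.exp (-K * x ^ s))
      (volume.restrict (Set.Ioi 0)) := by
    by_contra hcon
    rw [integral_undef hcon] at hval
    exact hpos.ne hval
  have hle : ∫⁻ t in Set.Ioi 0, P {ω | t < T ω} * ENNReal.ofReal (t ^ (p - 1))
      ≤ ENNReal.ofReal (K ^ (-(p - 1 + 1) / s) * (1 / s) * Real.Gamma ((p - 1 + 1) / s)) := by
    rw [← hval, ofReal_integral_eq_lintegral_ofReal hI]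
    · refine setLIntegral_mono' measurableSet_Ioi fun t ht => ?_
      rw [mul_comm, ENNReal.ofReal_mul (Real.rpow_nonneg (le_of_lt ht) _)]
      gcongr
      exact h t ht
    · filter_upwards [ae_restrict_mem measurableSet_Ioi] with t ht
      have : 0 < t := ht
      positivity
  refine (mul_le_mul_right hle _).trans ?_
  rw [← ENNReal.ofReal_mul hp0.le]
  refine ENNReal.ofReal_le_ofReal ?_
  rw [sub_add_cancel, Real.mul_rpow hp0.le (by positivity), ← Real.rpow_mul hK.le]
  have hG := Gamma_div_add_one_le hp hs
  rw [Real.Gamma_add_one (by positivity)] at hG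
  have e : p * (K ^ (-p / s) * (1 / s) * Real.Gamma (p / s))
      = (p / s * Real.Gamma (p / s)) * K ^ (-p / s) := by ring
  rw [e, show -(1 / s) * p = -p / s by ring]
  exact mul_le_mul_of_nonneg_right hG (by positivity)

/-! ### Random search with uniform starting points -/

/-- Maximum distance of the first `n` entries. -/
noncomputable def entryDist {d d' : ℕ} (n : ℕ) (θ : Fin d → ℝ) (θ' : Fin d' → ℝ) : ℝ :=
  ‖fun j : Fin n => entry θ j - entry θ' j‖

lemma abs_entry_sub_le_entryDist {d d' n : ℕ} (θ : Fin d → ℝ) (θ' : Fin d' → ℝ) {j : ℕ}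
    (hj : j < n) : |entry θ j - entry θ' j| ≤ entryDist n θ θ' :=
  norm_le_pi_norm (fun j : Fin n => entry θ j - entry θ' j) ⟨j, hj⟩

lemma continuous_entryDist {d d' : ℕ} (n : ℕ) (θ' : Fin d' → ℝ) :
    Continuous fun θ : Fin d → ℝ => entryDist n θ θ' :=
  (continuous_pi fun _ => (continuous_entry _).sub continuous_const).norm

lemma volume_Icc_neg_pos {d : ℕ} {c : ℝ} (hc : 0 < c) :
    volume (Set.Icc (fun _ : Fin d => -c) (fun _ : Fin d => c)) = ENNReal.ofReal ((2 * c) ^ d) := by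
  rw [Real.volume_Icc_pi, Finset.prod_const, Finset.card_univ, Fintype.card_fin,
    ENNReal.ofReal_pow (by linarith)]
  congr 2
  ring

/-- Even if `θ` lies on the boundary of the cube, each of the first `n` coordinates admits an
interval of length `2 * c * t` inside `[-c, c]` and within that distance of `θ`: the fraction `t` of
the edge. -/
lemma ofReal_le_measure_entryDist_le {Ω : Type*} [MeasurableSpace Ω] {P : Measure Ω}
    {d n : ℕ} (hn : n ≤ d) {c : ℝ} (hc : 0 < c) {U : Ω → Fin d → ℝ}
    (hU : pdf.IsUniform U (Set.Icc (fun _ => -c) (fun _ => c)) P volume)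
    {θ : Fin d → ℝ} (hθ : ∀ i, |θ i| ≤ c) {t : ℝ} (ht0 : 0 ≤ t) (ht1 : t ≤ 1) :
    ENNReal.ofReal (t ^ n) ≤ P {ω | entryDist n (U ω) θ ≤ 2 * c * t} := by
  have hvol := volume_Icc_neg_pos (d := d) hc
  have hvpos : 0 < (2 * c) ^ d := by positivity
  have hm := hU.measure_preimage (by rw [hvol]; simpa using hvpos) (by rw [hvol]; simp)
    (A := {x | entryDist n x θ ≤ 2 * c * t})
    (isClosed_le (continuous_entryDist n θ) continuous_const).measurableSet
  change _ ≤ P (U ⁻¹' {x | entryDist n x θ ≤ 2 * c * t})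
  rw [hm, hvol]
  set r := 2 * c * t with hr
  have hr0 : 0 ≤ r := by positivity
  have hr1 : r ≤ 2 * c := by nlinarith
  -- The interval `[θ i - r, θ i]` is shifted right if it would leave the cube; it then ends at `-c
  -- + r ≤ c`.
  set lo : Fin d → ℝ := fun i => if (i : ℕ) < n then max (θ i - r) (-c) else -c with hlo
  set hi : Fin d → ℝ := fun i => if (i : ℕ) < n then max (θ i - r) (-c) + r else c with hhi
  have hsub : Set.Icc lo hi ⊆
      Set.Icc (fun _ => -c) (fun _ => c) ∩ {x | entryDist n x θ ≤ r} := by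
    rintro x ⟨hx1, hx2⟩
    have hcase : ∀ i : Fin d, (i : ℕ) < n → -c ≤ x i ∧ x i ≤ c ∧ |x i - θ i| ≤ r := by
      intro i hin
      have h1 := hx1 i
      have h2 := hx2 i
      simp only [hlo, hhi, if_pos hin] at h1 h2
      have h3 := abs_le.1 (hθ i)
      rcases le_total (θ i - r) (-c) with h | h
      · rw [max_eq_right h] at h1 h2
        refine ⟨h1, by linarith, abs_le.2 ⟨by linarith, by linarith⟩⟩
      · rw [max_eq_left h] at h1 h2
        refine ⟨by linarith, by linarith, abs_le.2 ⟨by linarith, by linarith⟩⟩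
    have hcase' : ∀ i : Fin d, -c ≤ x i ∧ x i ≤ c := by
      intro i
      by_cases hin : (i : ℕ) < n
      · exact ⟨(hcase i hin).1, (hcase i hin).2.1⟩
      · have h1 := hx1 i
        have h2 := hx2 i
        simp only [hlo, hhi, if_neg hin] at h1 h2
        exact ⟨h1, h2⟩
    refine ⟨⟨fun i => (hcase' i).1, fun i => (hcase' i).2⟩, ?_⟩
    refine (pi_norm_le_iff_of_nonneg hr0).2 fun j => ?_
    have hjd : (j : ℕ) < d := j.2.trans_le hn
    have := (hcase ⟨j, hjd⟩ j.2).2.2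
    simpa [entry, hjd] using this
  have hvolsub : volume (Set.Icc lo hi) = ENNReal.ofReal (r ^ n * (2 * c) ^ (d - n)) := by
    rw [Real.volume_Icc_pi, ← ENNReal.ofReal_prod_of_nonneg]
    · congr 1
      have e : ∀ i : Fin d, hi i - lo i = (fun i : ℕ => if i < n then r else 2 * c) i := by
        intro i
        simp only [hlo, hhi]
        split_ifs <;> ring
      rw [Finset.prod_congr rfl fun i _ => e i,
        Fin.prod_univ_eq_prod_range (fun i : ℕ => if i < n then r else 2 * c) d]
      obtain ⟨m, rfl⟩ := Nat.exists_eq_add_of_le hn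
      rw [Finset.prod_range_add, Finset.prod_congr rfl (g := fun _ => r)
        fun i hi => if_pos (Finset.mem_range.1 hi)]
      simp
    · intro i _
      simp only [hlo, hhi]
      split_ifs <;> linarith
  calc ENNReal.ofReal (t ^ n)
      = ENNReal.ofReal (r ^ n * (2 * c) ^ (d - n)) / ENNReal.ofReal ((2 * c) ^ d) := by
        rw [← ENNReal.ofReal_div_of_pos hvpos]
        congr 1
        rw [eq_div_iff hvpos.ne', hr, mul_pow, ← Nat.add_sub_of_le hn, pow_add, Nat.add_sub_cancel_left]
        ring
    _ ≤ _ := by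
        rw [← hvolsub]
        exact ENNReal.div_le_div_right (measure_mono hsub) _

lemma isUniform_ae_abs_le {Ω : Type*} [MeasurableSpace Ω] {P : Measure Ω} [IsProbabilityMeasure P]
    {d : ℕ} {c : ℝ} (hc : 0 < c) {U : Ω → Fin d → ℝ}
    (hU : pdf.IsUniform U (Set.Icc (fun _ => -c) (fun _ => c)) P volume) :
    ∀ᵐ ω ∂P, ∀ i, |U ω i| ≤ c := by
  have hvol := volume_Icc_neg_pos (d := d) hc
  have hvpos : 0 < (2 * c) ^ d := by positivity
  have hm := hU.measure_preimage (by rw [hvol]; simpa using hvpos) (by rw [hvol]; simp)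
    (A := (Set.Icc (fun _ => -c) (fun _ => c))ᶜ) measurableSet_Icc.compl
  rw [Set.inter_compl_self, measure_empty, ENNReal.zero_div] at hm
  rw [ae_iff]
  refine measure_mono_null ?_ hm
  intro ω hω
  simp only [Set.mem_ofPred_eq, not_forall, not_le] at hω
  obtain ⟨i, hi⟩ := hω
  intro hmem
  exact absurd (abs_le.2 ⟨hmem.1 i, hmem.2 i⟩) (not_le.2 hi)

/-- Rate of convergence of random search for the first `n` entries of a parameter vector. -/
lemma eLpNorm_inf_entryDist_le {Ω : Type*} [MeasurableSpace Ω] {P : Measure Ω}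
    [IsProbabilityMeasure P] {d n K : ℕ} (hn0 : 0 < n) (hn : n ≤ d) (hK : 0 < K)
    {c : ℝ} (hc : 0 < c) {U : Fin K → Ω → Fin d → ℝ} (hUm : ∀ k, Measurable (U k))
    (hUi : iIndepFun U P)
    (hU : ∀ k, pdf.IsUniform (U k) (Set.Icc (fun _ => -c) (fun _ => c)) P volume)
    {θ : Fin d → ℝ} (hθ : ∀ i, |θ i| ≤ c) {p : ℝ} (hp : 1 ≤ p)
    (hne : (Finset.univ : Finset (Fin K)).Nonempty) :
    eLpNorm (fun ω => Finset.univ.inf' hne fun k => entryDist n (U k ω) θ) (ENNReal.ofReal p) P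
      ≤ ENNReal.ofReal (2 * c * (p * (K : ℝ) ^ (-(1 / (n : ℝ))))) := by
  have hK' : (0:ℝ) < K := by exact_mod_cast hK
  have hn' : (1:ℝ) ≤ n := by exact_mod_cast hn0
  have hc2 : 0 < 2 * c := by linarith
  set Z : Ω → ℝ := fun ω => Finset.univ.inf' hne fun k => entryDist n (U k ω) θ with hZ
  have hZm : Measurable Z := by
    have h1 : Continuous fun x : Fin K → ℝ => Finset.univ.inf' hne fun k => x k :=
      Continuous.finset_inf'_apply hne fun k _ => continuous_apply k
    exact h1.measurable.comp (measurable_pi_lambda _ fun k =>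
      (continuous_entryDist n θ).measurable.comp (hUm k))
  have hZ0 : ∀ ω, 0 ≤ Z ω := fun ω => Finset.le_inf' _ _ fun k _ => norm_nonneg _
  -- The exponential bound feeds the moment estimate. The sharper power is kept because it vanishes
  -- at `t = 1`, which settles all larger `t`.
  have htail : ∀ t, 0 ≤ t → t ≤ 1 →
      P {ω | t < Z ω / (2 * c)} ≤ ENNReal.ofReal (Real.exp (-K * t ^ (n : ℝ))) ∧
      P {ω | t < Z ω / (2 * c)} ≤ ENNReal.ofReal ((1 - t ^ n) ^ K) := by
    intro t ht0 ht1
    set B : Set (Fin d → ℝ) := {x | 2 * c * t < entryDist n x θ} with hB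
    have hBm : MeasurableSet B :=
      (isOpen_lt continuous_const (continuous_entryDist n θ)).measurableSet
    have hset : {ω | t < Z ω / (2 * c)} = ⋂ k ∈ (Finset.univ : Finset (Fin K)), U k ⁻¹' B := by
      ext ω
      simp only [Set.mem_ofPred_eq, Set.mem_iInter, Set.mem_preimage, hB, hZ, lt_div_iff₀ hc2,
        Finset.lt_inf'_iff]
      simp only [mul_comm]
    have hprob : P {ω | t < Z ω / (2 * c)} ≤ ENNReal.ofReal ((1 - t ^ n) ^ K) := by
      rw [hset, hUi.meas_biInter fun k _ => ⟨B, hBm, rfl⟩]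
      have h1 : ∀ k, P (U k ⁻¹' B) ≤ ENNReal.ofReal (1 - t ^ n) := by
        intro k
        have h2 := ofReal_le_measure_entryDist_le hn hc (hU k) hθ ht0 ht1
        have h3 : U k ⁻¹' B = {ω | entryDist n (U k ω) θ ≤ 2 * c * t}ᶜ := by
          ext ω; simp [hB]
        rw [h3, prob_compl_eq_one_sub, ENNReal.ofReal_sub _ (by positivity), ENNReal.ofReal_one]
        · exact tsub_le_tsub_left h2 _
        · exact measurableSet_le ((continuous_entryDist n θ).measurable.comp (hUm k))
            measurable_const
      refine (Finset.prod_le_prod' fun k _ => h1 k).trans_eq ?_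
      rw [Finset.prod_const, Finset.card_univ, Fintype.card_fin, ENNReal.ofReal_pow]
      exact sub_nonneg.2 (pow_le_one₀ ht0 ht1)
    refine ⟨hprob.trans (ENNReal.ofReal_le_ofReal ?_), hprob⟩
    rw [Real.rpow_natCast, neg_mul, ← mul_neg, Real.exp_nat_mul]
    refine pow_le_pow_left₀ (sub_nonneg.2 (pow_le_one₀ ht0 ht1)) ?_ _
    have := Real.add_one_le_exp (-t ^ n)
    linarith
  have hmain := eLpNorm_le_of_tail_le (P := P) (T := fun ω => Z ω / (2 * c)) (hZm.div_const _)
    (fun ω => div_nonneg (hZ0 ω) hc2.le) hp hn' hK' (by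
      intro t ht
      rcases le_total t 1 with h | h
      · exact (htail t ht.le h).1
      · have h1 := (htail 1 zero_le_one le_rfl).2
        rw [one_pow, sub_self, zero_pow hK.ne', ENNReal.ofReal_zero] at h1
        refine le_trans (measure_mono fun ω (hω : t < _) => lt_of_le_of_lt h hω) ?_
        exact h1.trans zero_le)
  have e : Z = (2 * c) • fun ω => Z ω / (2 * c) := by
    ext ω
    simp only [Pi.smul_apply, smul_eq_mul]
    field_simp
  rw [e, eLpNorm_const_smul, Real.enorm_eq_ofReal hc2.le, ENNReal.ofReal_mul hc2.le]
  gcongr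

/-! ### Generalisation error: sub-Gaussian maxima over a parameter grid -/

/-- Moments of the maximum of finitely many sub-Gaussian random variables. -/
lemma eLpNorm_sup_abs_le_of_hasSubgaussianMGF {Ω ι : Type*} [Fintype ι] [MeasurableSpace Ω]
    {P : Measure Ω} {F : ι → Ω → ℝ} (hF : ∀ i, Measurable (F i)) {v : NNReal}
    (hsub : ∀ i, HasSubgaussianMGF (F i) v P) {s q : ℝ} (hs : 0 < s) (hv : (v : ℝ) ≤ s ^ 2)
    (hq : 0 < q) (hcard : Real.log (2 * Fintype.card ι) ≤ q)
    (hne : (Finset.univ : Finset ι).Nonempty) :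
    eLpNorm (fun ω => Finset.univ.sup' hne fun i => |F i ω|) (ENNReal.ofReal q) P
      ≤ ENNReal.ofReal (Real.exp 1 * (s * Real.sqrt q)) := by
  have hsup0 : ∀ ω, 0 ≤ Finset.univ.sup' hne fun i => |F i ω| := fun ω => by
    obtain ⟨i, hi⟩ := hne
    exact (abs_nonneg (F i ω)).trans (Finset.le_sup' (fun i => |F i ω|) hi)
  refine eLpNorm_le_of_lintegral_rpow_le hsup0 hq (by positivity) ?_
  have hsq : 0 < Real.sqrt q := Real.sqrt_pos.2 hq
  have hsqq : Real.sqrt q * Real.sqrt q = q := Real.mul_self_sqrt hq.le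
  set lam := Real.sqrt q / s with hlam
  have hlam0 : 0 < lam := by positivity
  have hqlam : q / lam = s * Real.sqrt q := by
    rw [hlam]; field_simp; rw [pow_two, hsqq]
  -- From `x ≤ exp (x - 1)` at `x = lam * |y| / q`, raised to the power `q`. With `lam = √q / s`
  -- both exponential moments are at most `exp q`, which cancels `exp (-q)`.
  have hpt : ∀ y : ℝ, |y| ^ q ≤
      (s * Real.sqrt q) ^ q * Real.exp (-q) * (Real.exp (lam * y) + Real.exp (-lam * y)) := by
    intro y
    have h1 : lam * |y| / q ≤ Real.exp (lam * |y| / q - 1) := by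
      have := Real.add_one_le_exp (lam * |y| / q - 1); linarith
    have h2 := Real.rpow_le_rpow (by positivity) h1 hq.le
    rw [← Real.exp_mul] at h2
    have h3 : |y| = (s * Real.sqrt q) * (lam * |y| / q) := by
      rw [← hqlam]; field_simp
    have h4 : Real.exp (lam * |y|) ≤ Real.exp (lam * y) + Real.exp (-lam * y) := by
      rcases abs_cases y with ⟨h, _⟩ | ⟨h, _⟩ <;> rw [h]
      · linarith [Real.exp_pos (-lam * y)]
      · have : lam * -y = -lam * y := by ring
        rw [this]
        linarith [Real.exp_pos (lam * y)]
    calc |y| ^ q = ((s * Real.sqrt q) * (lam * |y| / q)) ^ q := by rw [← h3]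
      _ = (s * Real.sqrt q) ^ q * (lam * |y| / q) ^ q :=
        Real.mul_rpow (by positivity) (by positivity)
      _ ≤ (s * Real.sqrt q) ^ q * Real.exp ((lam * |y| / q - 1) * q) := by gcongr
      _ = (s * Real.sqrt q) ^ q * Real.exp (-q) * Real.exp (lam * |y|) := by
        rw [mul_assoc, ← Real.exp_add]
        congr 2
        field_simp
        ring
      _ ≤ _ := by gcongr
  have hmom : ∀ i, ∫⁻ ω, ENNReal.ofReal (|F i ω| ^ q) ∂P
      ≤ ENNReal.ofReal ((s * Real.sqrt q) ^ q * 2) := by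
    intro i
    have hi1 := (hsub i).integrable_exp_mul lam
    have hi2 := (hsub i).integrable_exp_mul (-lam)
    have hm1 := (hsub i).mgf_le lam
    have hm2 := (hsub i).mgf_le (-lam)
    have hexp : (v : ℝ) * lam ^ 2 / 2 ≤ q := by
      have : (v : ℝ) * lam ^ 2 ≤ s ^ 2 * lam ^ 2 := by gcongr
      have e : s ^ 2 * lam ^ 2 = q := by
        rw [hlam, div_pow, Real.sq_sqrt hq.le]; field_simp
      linarith
    rw [neg_sq] at hm2
    have hE := Real.exp_le_exp.2 hexp
    calc ∫⁻ ω, ENNReal.ofReal (|F i ω| ^ q) ∂P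
        ≤ ∫⁻ ω, ENNReal.ofReal ((s * Real.sqrt q) ^ q * Real.exp (-q) *
          (Real.exp (lam * F i ω) + Real.exp (-lam * F i ω))) ∂P :=
          lintegral_mono fun ω => ENNReal.ofReal_le_ofReal (hpt _)
      _ = ENNReal.ofReal (∫ ω, (s * Real.sqrt q) ^ q * Real.exp (-q) *
          (Real.exp (lam * F i ω) + Real.exp (-lam * F i ω)) ∂P) := by
          have hi12 : Integrable (fun ω => Real.exp (lam * F i ω) + Real.exp (-lam * F i ω)) P :=
            hi1.add hi2
          rw [ofReal_integral_eq_lintegral_ofReal (hi12.const_mul _)]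
          exact ae_of_all _ fun ω => by positivity
      _ ≤ _ := by
          refine ENNReal.ofReal_le_ofReal ?_
          rw [integral_const_mul, integral_add hi1 hi2, mul_assoc]
          refine mul_le_mul_of_nonneg_left ?_ (by positivity)
          rw [← le_div_iff₀' (Real.exp_pos _), Real.exp_neg, div_inv_eq_mul]
          simp only [mgf] at hm1 hm2
          linarith
  -- The maximum is bounded by the sum; the resulting factor, twice the cardinality, is at most `exp
  -- q` and becomes `exp 1` in the `q`-th root.
  calc ∫⁻ ω, ENNReal.ofReal ((Finset.univ.sup' hne fun i => |F i ω|) ^ q) ∂P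
      ≤ ∫⁻ ω, ∑ i, ENNReal.ofReal (|F i ω| ^ q) ∂P := by
        refine lintegral_mono fun ω => ?_
        obtain ⟨i, hi, he⟩ := Finset.exists_mem_eq_sup' hne fun i => |F i ω|
        simp only [he]
        exact Finset.single_le_sum (f := fun i => ENNReal.ofReal (|F i ω| ^ q))
          (fun _ _ => zero_le) hi
    _ = ∑ i, ∫⁻ ω, ENNReal.ofReal (|F i ω| ^ q) ∂P :=
        lintegral_finsetSum _ fun i _ => ((hF i).abs.pow_const q).ennreal_ofReal
    _ ≤ ∑ _i : ι, ENNReal.ofReal ((s * Real.sqrt q) ^ q * 2) :=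
        Finset.sum_le_sum fun i _ => hmom i
    _ = ENNReal.ofReal ((s * Real.sqrt q) ^ q * (2 * Fintype.card ι)) := by
        rw [Finset.sum_const, Finset.card_univ, nsmul_eq_mul, ← ENNReal.ofReal_natCast,
          ← ENNReal.ofReal_mul (by positivity)]
        congr 1; ring
    _ ≤ _ := by
        refine ENNReal.ofReal_le_ofReal ?_
        rw [Real.mul_rpow (Real.exp_pos _).le (by positivity), mul_comm]
        refine mul_le_mul_of_nonneg_right ?_ (by positivity)
        have hpos : (0:ℝ) < 2 * Fintype.card ι := by
          have : 0 < Fintype.card ι := Finset.card_pos.2 hne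
          positivity
        rw [← Real.exp_mul, one_mul]
        exact (Real.log_le_iff_le_exp hpos).1 hcard

/-- Hoeffding's lemma for the centred empirical mean of bounded independent random variables. -/
lemma hasSubgaussianMGF_mean {Ω : Type*} [MeasurableSpace Ω] {P : Measure Ω}
    [IsProbabilityMeasure P] {M : ℕ} {f : Fin M → Ω → ℝ} (hf : ∀ j, Measurable (f j))
    (hindep : iIndepFun f P) {D m : ℝ} (hfD : ∀ j ω, f j ω ∈ Set.Icc 0 D)
    (hm : ∀ j, ∫ ω, f j ω ∂P = m) (hM : 0 < M) :
    ∃ w : NNReal, (w : ℝ) = D ^ 2 / (4 * M) ∧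
      HasSubgaussianMGF (fun ω => 1 / (M : ℝ) * ∑ j, f j ω - m) w P := by
  have hM' : (M : ℝ) ≠ 0 := by exact_mod_cast hM.ne'
  have h1 : ∀ j ∈ (Finset.univ : Finset (Fin M)),
      HasSubgaussianMGF (fun ω => f j ω - m) ((‖D - 0‖₊ / 2) ^ 2) P := by
    intro j _
    have := hasSubgaussianMGF_of_mem_Icc (hf j).aemeasurable (ae_of_all P (hfD j))
    rwa [hm j] at this
  have h2 : iIndepFun (fun j ω => f j ω - m) P :=
    hindep.comp (fun _ x => x - m) fun _ => measurable_id.sub_const m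
  have h3 := (HasSubgaussianMGF.sum_of_iIndepFun h2 h1).const_mul (1 / (M : ℝ))
  refine ⟨_, ?_, h3.congr (ae_of_all _ fun ω => ?_)⟩
  · change (1 / (M : ℝ)) ^ 2 * ((∑ _j : Fin M, (‖D - 0‖₊ / 2) ^ 2 : NNReal) : ℝ) = _
    simp only [sub_zero, Finset.sum_const, Finset.card_univ, Fintype.card_fin, nsmul_eq_mul]
    push_cast
    rw [Real.norm_eq_abs, div_pow |D|, sq_abs]
    field_simp
    norm_num
  · simp only [Finset.sum_sub_distrib, Finset.sum_const, Finset.card_univ, Fintype.card_fin,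
      nsmul_eq_mul]
    field_simp

/-- The midpoints of `m` equal subintervals of `[-B, B]`. -/
noncomputable def gridPoint (B : ℝ) (m : ℕ) (k : ℕ) : ℝ := -B + (2 * k + 1) * (B / m)

lemma abs_gridPoint_le {B : ℝ} (hB : 0 ≤ B) {m k : ℕ} (hk : k < m) : |gridPoint B m k| ≤ B := by
  have hm : (0:ℝ) < m := by exact_mod_cast (Nat.zero_le k).trans_lt hk
  have hk' : (k:ℝ) + 1 ≤ m := by exact_mod_cast hk
  have h0 : 0 ≤ B / m := by positivity
  have h1 : m * (B / m) = B := by field_simp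
  have h2 : (k:ℝ) * (B / m) + B / m ≤ B := by
    have := mul_le_mul_of_nonneg_right hk' h0; linarith
  have h3 : 0 ≤ (k:ℝ) * (B / m) := by positivity
  unfold gridPoint
  rw [abs_le]
  constructor <;> linarith

lemma exists_gridPoint_close {B : ℝ} (hB : 0 < B) {m : ℕ} (hm : 0 < m) {x : ℝ} (hx : |x| ≤ B) :
    ∃ k < m, |x - gridPoint B m k| ≤ B / m := by
  have hm' : (0:ℝ) < m := by exact_mod_cast hm
  have hh : 0 < B / m := by positivity
  have h1 : m * (B / m) = B := by field_simp
  obtain ⟨hx1, hx2⟩ := abs_le.1 hx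
  -- The right endpoint belongs to the last cell, while the floor would give `m`.
  rcases eq_or_lt_of_le hx2 with rfl | hx2
  · refine ⟨m - 1, by omega, ?_⟩
    unfold gridPoint
    rw [Nat.cast_sub hm]
    have e : x - (-x + (2 * ((m:ℝ) - (1 : ℕ)) + 1) * (x / m)) = x / m := by
      push_cast; linear_combination (-2) * h1
    rw [e, abs_of_pos hh]
  · have hq : 0 ≤ (x + B) / (2 * (B / m)) := div_nonneg (by linarith) (by linarith)
    refine ⟨⌊(x + B) / (2 * (B / m))⌋₊, ?_, ?_⟩
    · rw [Nat.floor_lt hq, div_lt_iff₀ (by linarith)]; linarith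
    · have h2 := Nat.floor_le hq
      have h3 := (Nat.lt_floor_add_one ((x + B) / (2 * (B / m)))).le
      rw [le_div_iff₀ (by linarith)] at h2
      rw [div_le_iff₀ (by linarith)] at h3
      unfold gridPoint
      rw [abs_le]
      constructor <;> linarith

/-- In the difference of squares, the factor `(x - y) + (x' - y)` is at most `2 * (v - u)` in
absolute value. -/
lemma abs_sq_sub_sq_le {u v : ℝ} {x x' y : ℝ} (hx : x ∈ Set.Icc u v) (hx' : x' ∈ Set.Icc u v)
    (hy : y ∈ Set.Icc u v) : abs (|x - y| ^ 2 - |x' - y| ^ 2) ≤ 2 * (v - u) * |x - x'| := by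
  rw [sq_abs, sq_abs, show (x - y) ^ 2 - (x' - y) ^ 2 = ((x - y) + (x' - y)) * (x - x') by ring,
    abs_mul]
  refine mul_le_mul_of_nonneg_right ?_ (abs_nonneg _)
  rw [abs_le]
  constructor <;> linarith [hx.1, hx.2, hx'.1, hx'.2, hy.1, hy.2]

lemma abs_sub_sq_mem_Icc {u v x y : ℝ} (hx : x ∈ Set.Icc u v) (hy : y ∈ Set.Icc u v) :
    |x - y| ^ 2 ∈ Set.Icc 0 ((v - u) ^ 2) := by
  refine ⟨by positivity, ?_⟩
  rw [sq_abs]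
  refine sq_le_sq' ?_ ?_ <;> linarith [hx.1, hx.2, hy.1, hy.2]

/-- The empirical risk is Lipschitz continuous for the uniform distance. -/
lemma empiricalRisk_sub_abs_le {M : ℕ} (hM : 0 < M) {u v η : ℝ} (huv : u ≤ v) {f g : ℝ → ℝ}
    {x y : Fin M → ℝ} (hf : ∀ z, f z ∈ Set.Icc u v) (hg : ∀ z, g z ∈ Set.Icc u v)
    (hy : ∀ j, y j ∈ Set.Icc u v) (hfg : ∀ j, |f (x j) - g (x j)| ≤ η) :
    |empiricalRisk f x y - empiricalRisk g x y| ≤ 2 * (v - u) * η := by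
  have hM' : (0:ℝ) < M := by exact_mod_cast hM
  unfold empiricalRisk
  rw [← mul_sub, ← Finset.sum_sub_distrib, abs_mul, abs_of_pos (by positivity),
    one_div_mul_eq_div, div_le_iff₀ hM']
  refine (Finset.abs_sum_le_sum_abs _ _).trans ?_
  refine (Finset.sum_le_card_nsmul _ _ (2 * (v - u) * η) fun j _ => ?_).trans_eq
    (by rw [Finset.card_univ, Fintype.card_fin, nsmul_eq_mul, mul_comm])
  refine (abs_sq_sub_sq_le (hf _) (hg _) (hy j)).trans ?_
  exact mul_le_mul_of_nonneg_left (hfg j) (by linarith)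

/-- The risk is Lipschitz continuous for the uniform distance. -/
lemma risk_sub_abs_le {Ω : Type*} [MeasurableSpace Ω] {P : Measure Ω}
    [IsProbabilityMeasure P] {u v η : ℝ} (huv : u ≤ v) {f g : ℝ → ℝ} (hfm : Measurable f)
    (hgm : Measurable g) (hf : ∀ z, f z ∈ Set.Icc u v) (hg : ∀ z, g z ∈ Set.Icc u v)
    {X Y : Ω → ℝ} (hX : Measurable X) (hY : Measurable Y) (hYmem : ∀ ω, Y ω ∈ Set.Icc u v)
    (hfg : ∀ ω, |f (X ω) - g (X ω)| ≤ η) :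
    |∫ ω, |f (X ω) - Y ω| ^ 2 ∂P - ∫ ω, |g (X ω) - Y ω| ^ 2 ∂P| ≤ 2 * (v - u) * η := by
  have hint : ∀ {h : ℝ → ℝ}, Measurable h → (∀ z, h z ∈ Set.Icc u v) →
      Integrable (fun ω => |h (X ω) - Y ω| ^ 2) P := fun hm hmem =>
    Integrable.of_mem_Icc 0 ((v - u) ^ 2)
      (((hm.comp hX).sub hY).abs.pow_const 2).aemeasurable
      (ae_of_all _ fun ω => abs_sub_sq_mem_Icc (hmem _) (hYmem ω))
  rw [← integral_sub (hint hfm hf) (hint hgm hg)]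
  have hle := norm_integral_le_of_norm_le_const (μ := P) (C := 2 * (v - u) * η)
    (f := fun ω => |f (X ω) - Y ω| ^ 2 - |g (X ω) - Y ω| ^ 2) (ae_of_all _ fun ω => ?_)
  · rwa [probReal_univ, mul_one] at hle
  refine (abs_sq_sub_sq_le (hf _) (hg _) (hYmem ω)).trans ?_
  exact mul_le_mul_of_nonneg_left (hfg ω) (by linarith)

/-- The extra 1 pays for the factor 2 in `log (2 * m ^ n) ≤ (n + 1) * log m`. -/
lemma paramCount_add_one_le {L : ℕ} (hL : 1 ≤ L) {l : ℕ → ℕ} {w : ℝ}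
    (hw : ∀ j ≤ L, (l j : ℝ) + 1 ≤ w) : (paramCount l L : ℝ) + 1 ≤ L * w ^ 2 := by
  have hw1 : 1 ≤ w := le_trans (by simp) (hw 0 (Nat.zero_le _))
  have h1 : (paramCount l L : ℝ) ≤ L * ((w - 1) * w) := by
    unfold paramCount
    push_cast
    refine (Finset.sum_le_card_nsmul _ _ ((w - 1) * w) fun i hi => ?_).trans_eq (by simp)
    have hi' := Finset.mem_range.1 hi
    have h2 := hw (i + 1) (by omega)
    exact mul_le_mul (by linarith) (hw i (by omega)) (by positivity) (by linarith)
  have hL' : (1:ℝ) ≤ L := by exact_mod_cast hL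
  have : 1 ≤ L * w := by nlinarith
  nlinarith

lemma abs_entry_le {d : ℕ} {θ : Fin d → ℝ} {B : ℝ} (hB : 0 ≤ B) (hθ : ∀ i, |θ i| ≤ B) (j : ℕ) :
    |entry θ j| ≤ B := by
  unfold entry
  split_ifs
  · exact hθ _
  · simpa using hB

/-- Entropy of the grid: `n + 1` is at most `L * w ^ 2`, and `log m ≤ L * (log w + log Q) ≤ L * w *
T`. The product `L ^ 2 * w ^ 3 * T` explains the power `3 / 2` of the width after taking a root. -/
lemma log_two_mul_pow_le {L n m : ℕ} {w Q T : ℝ} (hm : 2 ≤ m) (hw : 1 ≤ w)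
    (hn : (n : ℝ) + 1 ≤ L * w ^ 2) (hQ : 0 < Q) (hmQ : (m : ℝ) ≤ (w * Q) ^ L) (hT1 : 1 ≤ T)
    (hTQ : Real.log Q ≤ T) :
    Real.log (2 * (m : ℝ) ^ n) ≤ (L * w ^ (3 / 2 : ℝ) * T) ^ 2 := by
  have hm' : (2:ℝ) ≤ m := by exact_mod_cast hm
  have hm0 : (0:ℝ) < m := by linarith
  have hlm0 : 0 ≤ Real.log m := Real.log_nonneg (by linarith)
  have hw0 : 0 < w := by linarith
  have h1 : Real.log m ≤ L * (w * T) := by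
    have h2 := Real.log_le_log hm0 hmQ
    rw [Real.log_pow, Real.log_mul hw0.ne' hQ.ne'] at h2
    have h3 := Real.log_le_sub_one_of_pos hw0
    refine h2.trans (mul_le_mul_of_nonneg_left ?_ (Nat.cast_nonneg _))
    nlinarith
  have hw32 : (w ^ (3 / 2 : ℝ)) ^ 2 = w ^ 3 := by
    rw [← Real.rpow_natCast, ← Real.rpow_mul hw0.le, ← Real.rpow_natCast]; norm_num
  rw [mul_pow, mul_pow, hw32, Real.log_mul two_ne_zero (by positivity), Real.log_pow]
  have h4 := Real.log_le_log two_pos hm'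
  calc Real.log 2 + n * Real.log m ≤ (n + 1) * Real.log m := by linarith
    _ ≤ L * w ^ 2 * (L * (w * T)) := mul_le_mul hn h1 hlm0 (by positivity)
    _ = (L : ℝ) ^ 2 * w ^ 3 * (T * 1) := by ring
    _ ≤ (L : ℝ) ^ 2 * w ^ 3 * T ^ 2 := by
        rw [pow_two T]
        gcongr

/-- The number of grid points per coordinate that makes the discretisation error negligible. -/
lemma exists_gridSize {L M : ℕ} (hL : 2 ≤ L) (hM : 0 < M) {w β c : ℝ} (hw : 1 ≤ w) (hβ : 1 ≤ β)
    (hc : 1 ≤ c) : ∃ m : ℕ, 2 ≤ m ∧ 4 * (L * w ^ L * β ^ (L - 1) * c * (β / m)) * Real.sqrt M ≤ 1 ∧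
      (m : ℝ) ≤ (w * (4 * M * β * c)) ^ L := by
  have hM' : (1:ℝ) ≤ M := by exact_mod_cast hM
  have hL' : (2:ℝ) ≤ L := by exact_mod_cast hL
  have hsM : 1 ≤ Real.sqrt M := Real.one_le_sqrt.2 hM'
  have hsM' : Real.sqrt M ≤ (M : ℝ) ^ L :=
    (Real.sqrt_le_left (by linarith)).2 (by nlinarith) |>.trans (le_self_pow₀ hM' (by omega))
  have hwL : 1 ≤ w ^ L := one_le_pow₀ hw
  have hβL : 1 ≤ β ^ L := one_le_pow₀ hβ
  set a : ℝ := w ^ L * β ^ L * c * Real.sqrt M with ha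
  have ha1 : 1 ≤ a := by
    rw [ha]
    exact one_le_mul_of_one_le_of_one_le (one_le_mul_of_one_le_of_one_le
      (one_le_mul_of_one_le_of_one_le hwL hβL) hc) hsM
  have hLa : 2 ≤ L * a := by nlinarith
  have hceil := Nat.le_ceil (4 * (L * a))
  have hm0 : (0:ℝ) < ⌈4 * (L * a)⌉₊ := by linarith
  refine ⟨⌈4 * (L * a)⌉₊, ?_, ?_, ?_⟩
  · have : (2:ℝ) ≤ ⌈4 * (L * a)⌉₊ := by linarith
    exact_mod_cast this
  · have hpow : β ^ L = β ^ (L - 1) * β := by rw [← pow_succ]; congr 1; omega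
    have e : 4 * (L * w ^ L * β ^ (L - 1) * c * (β / ⌈4 * (L * a)⌉₊)) * Real.sqrt M
        = 4 * (L * a) / ⌈4 * (L * a)⌉₊ := by
      rw [ha, hpow]; ring
    rw [e, div_le_one hm0]
    exact hceil
  -- Rounding up turns 4 into 5, and `5 * L` is absorbed into `4 ^ L`; this needs `2 ≤ L`.
  · have h5 : ∀ k : ℕ, 2 ≤ k → 5 * k ≤ 4 ^ k := by
      intro k hk
      induction k, hk using Nat.le_induction with
      | base => norm_num
      | succ k hk ih => rw [pow_succ]; omega
    have h5' : 5 * (L:ℝ) ≤ 4 ^ L := by exact_mod_cast h5 L hL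
    have h6 := (Nat.ceil_lt_add_one (show 0 ≤ 4 * (L * a) by positivity)).le
    have hcL : c ≤ c ^ L := le_self_pow₀ hc (by omega)
    calc (⌈4 * (L * a)⌉₊ : ℝ) ≤ 5 * L * a := by linarith
      _ ≤ 4 ^ L * (w ^ L * β ^ L * c ^ L * M ^ L) := by
        rw [ha]; gcongr
      _ = _ := by simp only [mul_pow]; ring

/-- Uniform generalisation error over all parameter vectors bounded by `β`. -/
lemma exists_generalization_bound {Ω : Type*} [MeasurableSpace Ω] {P : Measure Ω}
    [IsProbabilityMeasure P] {d L M : ℕ} (hM : 0 < M) {l : ℕ → ℕ} (h0 : l 0 = 1) (hlL : l L = 1)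
    (hL : 2 ≤ L) {u v β c w p : ℝ} (huv : u < v) (hw : ∀ j ≤ L, (l j : ℝ) + 1 ≤ w)
    (hc : 1 ≤ c) (hβ : 1 ≤ β) (hp : 1 ≤ p) {X Y : Fin M → Ω → ℝ}
    (hX : ∀ j, Measurable (X j)) (hY : ∀ j, Measurable (Y j)) (hXc : ∀ j ω, |X j ω| ≤ c)
    (hYmem : ∀ j ω, Y j ω ∈ Set.Icc u v)
    (hindep : iIndepFun (fun (j : Fin M) (ω : Ω) => (X j ω, Y j ω)) P)
    (hident : ∀ i j : Fin M,
      IdentDistrib (fun ω => (X i ω, Y i ω)) (fun ω => (X j ω, Y j ω)) P P) (j₀ : Fin M) :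
    ∃ G : Ω → ℝ, Measurable G ∧
      (∀ θ : Fin d → ℝ, (∀ j < paramCount l L, |entry θ j| ≤ β) → ∀ ω,
        |empiricalRisk (realDNN L l h0 hlL u v θ) (fun j => X j ω) (fun j => Y j ω)
          - ∫ ω', |realDNN L l h0 hlL u v θ (X j₀ ω') - Y j₀ ω'| ^ 2 ∂P| ≤ G ω) ∧
      eLpNorm G (ENNReal.ofReal p) P ≤ ENNReal.ofReal (5 * (max (v - u) 1) ^ 2 * L
        * w ^ (3 / 2 : ℝ) * max p (Real.log (4 * M * β * c)) / Real.sqrt M) := by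
  have hw1 : 1 ≤ w := le_trans (by simp) (hw 0 (Nat.zero_le _))
  have hw0 : 0 < w := by linarith
  have hM' : (0:ℝ) < M := by exact_mod_cast hM
  have hL' : (2:ℝ) ≤ L := by exact_mod_cast hL
  have hsM : 0 < Real.sqrt M := Real.sqrt_pos.2 hM'
  have hsMsq : Real.sqrt M ^ 2 = M := Real.sq_sqrt hM'.le
  obtain ⟨m, hm2, hm1, hmle⟩ := exists_gridSize (M := M) hL hM hw1 hβ hc
  have hm0 : (0:ℝ) < m := by have : 0 < m := by omega
                             exact_mod_cast this
  set n := paramCount l L with hn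
  set D := max (v - u) 1 with hD
  have hD1 : 1 ≤ D := le_max_right _ _
  have hDuv : v - u ≤ D := le_max_left _ _
  set T := max p (Real.log (4 * M * β * c)) with hT
  have hTp : p ≤ T := le_max_left _ _
  have hT1 : 1 ≤ T := hp.trans hTp
  -- The moment of order `r ^ 2` will be used: it dominates both `p` and the logarithm of twice the
  -- grid size.
  set r : ℝ := L * w ^ (3 / 2 : ℝ) * T with hr
  have hw32 : 1 ≤ w ^ (3 / 2 : ℝ) := Real.one_le_rpow hw1 (by norm_num)
  have hrT : T ≤ r := by
    rw [hr]
    have : 1 ≤ L * w ^ (3 / 2 : ℝ) := one_le_mul_of_one_le_of_one_le (by linarith) hw32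
    nlinarith
  have hr1 : 1 ≤ r := hT1.trans hrT
  -- The length `e` is left free because grid vectors have `n` entries and `θ` has `d`.
  set N : (e : ℕ) → (Fin e → ℝ) → ℝ → ℝ := fun _ θ => realDNN L l h0 hlL u v θ with hN
  have hNmem : ∀ {e : ℕ} (θ : Fin e → ℝ) x, N _ θ x ∈ Set.Icc u v := fun θ x =>
    realDNN_mem_Icc h0 hlL (by omega) huv.le θ x
  have hNm : ∀ {e : ℕ} (θ : Fin e → ℝ), Measurable (N _ θ) := fun θ =>
    (continuous_realDNN h0 hlL u v).measurable.comp (measurable_const.prodMk measurable_id)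
  set F : (e : ℕ) → (Fin e → ℝ) → Ω → ℝ := fun _ θ ω =>
    empiricalRisk (N _ θ) (fun j => X j ω) (fun j => Y j ω)
      - ∫ ω', |N _ θ (X j₀ ω') - Y j₀ ω'| ^ 2 ∂P with hF
  have hloss : ∀ {e : ℕ} (θ : Fin e → ℝ), Measurable fun q : ℝ × ℝ => |N _ θ q.1 - q.2| ^ 2 :=
    fun θ => (((hNm θ).comp measurable_fst).sub measurable_snd).abs.pow_const 2
  have hFm : ∀ {e : ℕ} (θ : Fin e → ℝ), Measurable (F _ θ) := fun θ =>
    ((Finset.measurable_sum _ fun j _ =>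
      (hloss θ).comp ((hX j).prodMk (hY j))).const_mul _).sub_const _
  have hFsub : ∀ {e : ℕ} (θ : Fin e → ℝ),
      HasSubgaussianMGF (F _ θ) (Real.toNNReal (((v - u) ^ 2) ^ 2 / (4 * M))) P := by
    intro e θ
    obtain ⟨w', hw', h⟩ := hasSubgaussianMGF_mean (P := P)
      (f := fun j ω => |N _ θ (X j ω) - Y j ω| ^ 2) (D := (v - u) ^ 2)
      (m := ∫ ω', |N _ θ (X j₀ ω') - Y j₀ ω'| ^ 2 ∂P)
      (fun j => (hloss θ).comp ((hX j).prodMk (hY j)))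
      (hindep.comp (fun _ q => |N _ θ q.1 - q.2| ^ 2) fun _ => hloss θ)
      (fun j ω => abs_sub_sq_mem_Icc (hNmem θ _) (hYmem j ω))
      (fun j => ((hident j j₀).comp (hloss θ)).integral_eq) hM
    rw [← hw', Real.toNNReal_coe]
    exact h
  set ψ : (Fin n → Fin m) → Fin n → ℝ := fun k j => gridPoint β m (k j) with hψ
  have hψβ : ∀ k j, |entry (ψ k) j| ≤ β := fun k j =>
    abs_entry_le (by linarith) (fun i => abs_gridPoint_le (by linarith) (k i).2) j
  have hne : (Finset.univ : Finset (Fin n → Fin m)).Nonempty :=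
    ⟨fun _ => ⟨0, by omega⟩, Finset.mem_univ _⟩
  set S : Ω → ℝ := fun ω => Finset.univ.sup' hne fun k => |F _ (ψ k) ω| with hS
  have hSm : Measurable S := by
    have h1 : Continuous fun x : (Fin n → Fin m) → ℝ => Finset.univ.sup' hne fun k => x k :=
      Continuous.finset_sup'_apply hne fun k _ => continuous_apply k
    exact h1.measurable.comp (measurable_pi_lambda _ fun k => (hFm (ψ k)).abs)
  -- The added constant is the discretisation error, incurred once for the empirical and once for
  -- the true risk.
  refine ⟨fun ω => S ω + D ^ 2 / Real.sqrt M, hSm.add_const _, ?_, ?_⟩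
  · intro θ hθ ω
    have hex : ∀ j : Fin n, ∃ k : Fin m, |entry θ j - gridPoint β m k| ≤ β / m := by
      intro j
      obtain ⟨k, hk, h⟩ := exists_gridPoint_close (by linarith) (show 0 < m by omega) (hθ j j.2)
      exact ⟨⟨k, hk⟩, h⟩
    choose k hk using hex
    have hclose : ∀ x, |x| ≤ c → |N _ θ x - N _ (ψ k) x| ≤ L * w ^ L * β ^ (L - 1) * c * (β / m) := by
      intro x hx
      refine realDNN_sub_abs_le h0 hlL hc hβ (by positivity) hx hw hθ (fun j _ => hψβ k j) ?_
      intro j hj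
      have : entry (ψ k) j = gridPoint β m (k ⟨j, hj⟩) := by
        have hj' : j < n := hj
        simp [entry, hj', hψ]
      rw [this]
      exact hk ⟨j, hj⟩
    set η := L * w ^ L * β ^ (L - 1) * c * (β / m) with hη
    have hη0 : 0 ≤ η := by positivity
    have b1 := empiricalRisk_sub_abs_le hM huv.le (hNmem θ) (hNmem (ψ k)) (x := fun j => X j ω)
      (y := fun j => Y j ω) (fun j => hYmem j ω) (fun j => hclose _ (hXc j ω))
    have b2 := risk_sub_abs_le (P := P) huv.le (hNm θ) (hNm (ψ k)) (hNmem θ) (hNmem (ψ k)) (hX j₀)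
      (hY j₀) (hYmem j₀) (fun ω' => hclose _ (hXc j₀ ω'))
    have b3 : |F _ (ψ k) ω| ≤ S ω := Finset.le_sup' (fun k => |F _ (ψ k) ω|) (Finset.mem_univ k)
    have b4 : 4 * (v - u) * η ≤ D ^ 2 / Real.sqrt M := by
      rw [le_div_iff₀ hsM]
      have : D * (4 * η * Real.sqrt M) ≤ D * 1 := mul_le_mul_of_nonneg_left hm1 (by linarith)
      have : (v - u) * (4 * η * Real.sqrt M) ≤ D * (4 * η * Real.sqrt M) :=
        mul_le_mul_of_nonneg_right hDuv (by positivity)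
      nlinarith
    change |F _ θ ω| ≤ S ω + D ^ 2 / Real.sqrt M
    have b5 : |F _ θ ω - F _ (ψ k) ω| ≤ 4 * (v - u) * η := by
      have e : F _ θ ω - F _ (ψ k) ω
        = (empiricalRisk (N _ θ) (fun j => X j ω) (fun j => Y j ω)
            - empiricalRisk (N _ (ψ k)) (fun j => X j ω) (fun j => Y j ω))
          - (∫ ω', |N _ θ (X j₀ ω') - Y j₀ ω'| ^ 2 ∂P
            - ∫ ω', |N _ (ψ k) (X j₀ ω') - Y j₀ ω'| ^ 2 ∂P) := by
        simp only [hF]; ring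
      rw [e]
      refine (abs_sub _ _).trans ?_
      linarith
    have b6 := abs_sub_abs_le_abs_sub (F _ θ ω) (F _ (ψ k) ω)
    linarith
  · have hrq : Real.sqrt (r ^ 2) = r := Real.sqrt_sq (by linarith)
    have hpq : p ≤ r ^ 2 := by nlinarith
    have hnw : (n : ℝ) + 1 ≤ L * w ^ 2 := paramCount_add_one_le (by omega) hw
    have hcard : Real.log (2 * Fintype.card (Fin n → Fin m)) ≤ r ^ 2 := by
      have := log_two_mul_pow_le hm2 hw1 hnw (Q := 4 * M * β * c) (by positivity) hmle hT1
        (le_max_right _ _)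
      simpa using this
    have hs : 0 < D ^ 2 / Real.sqrt M := by positivity
    have hvs : ((Real.toNNReal (((v - u) ^ 2) ^ 2 / (4 * M)) : NNReal) : ℝ)
        ≤ (D ^ 2 / Real.sqrt M) ^ 2 := by
      rw [Real.coe_toNNReal _ (by positivity), div_pow, hsMsq]
      have h1 : (v - u) ^ 2 ≤ D ^ 2 := pow_le_pow_left₀ (by linarith) hDuv 2
      have h2 : ((v - u) ^ 2) ^ 2 ≤ (D ^ 2) ^ 2 := pow_le_pow_left₀ (by positivity) h1 2
      exact div_le_div₀ (by positivity) h2 hM' (by linarith)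
    have hmax := eLpNorm_sup_abs_le_of_hasSubgaussianMGF (fun k => hFm (ψ k))
      (fun k => hFsub (ψ k)) hs hvs (by positivity) hcard hne
    rw [hrq] at hmax
    calc eLpNorm (fun ω => S ω + D ^ 2 / Real.sqrt M) (ENNReal.ofReal p) P
        ≤ eLpNorm (fun ω => S ω + D ^ 2 / Real.sqrt M) (ENNReal.ofReal (r ^ 2)) P :=
          eLpNorm_le_eLpNorm_of_exponent_le (ENNReal.ofReal_le_ofReal hpq)
            (hSm.add_const _).aestronglyMeasurable
      _ ≤ eLpNorm S (ENNReal.ofReal (r ^ 2)) P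
          + eLpNorm (fun _ => D ^ 2 / Real.sqrt M) (ENNReal.ofReal (r ^ 2)) P :=
          eLpNorm_add_le hSm.aestronglyMeasurable aestronglyMeasurable_const
            (ENNReal.one_le_ofReal.2 (hp.trans hpq))
      _ ≤ ENNReal.ofReal (Real.exp 1 * (D ^ 2 / Real.sqrt M * r))
          + ENNReal.ofReal (D ^ 2 / Real.sqrt M) := by
          refine add_le_add hmax (le_of_eq ?_)
          rw [eLpNorm_const' _ (by simp; positivity) ENNReal.ofReal_ne_top, measure_univ,
            ENNReal.one_rpow, mul_one, Real.enorm_eq_ofReal hs.le]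
      _ ≤ _ := by
          rw [← ENNReal.ofReal_add (by positivity) hs.le]
          refine ENNReal.ofReal_le_ofReal ?_
          have e : 5 * D ^ 2 * L * w ^ (3 / 2 : ℝ) * T / Real.sqrt M
              = 5 * (D ^ 2 / Real.sqrt M * r) := by rw [hr]; ring
          rw [e]
          -- The maximum contributes `exp 1` and the discretisation at most 1, together less than 5.
          have h1 := Real.exp_one_lt_d9
          have h2 : D ^ 2 / Real.sqrt M ≤ D ^ 2 / Real.sqrt M * r :=
            le_mul_of_one_le_right hs.le hr1
          nlinarith

/-! ### Risk decomposition and final reductions -/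

/-- Bias-variance decomposition of the risk. -/
lemma risk_eq_add {Ω : Type*} [MeasurableSpace Ω] {P : Measure Ω}
    [IsProbabilityMeasure P] {u v : ℝ} {f g : ℝ → ℝ} (hfm : Measurable f) (hgm : Measurable g)
    (hf : ∀ z, f z ∈ Set.Icc u v) (hg : ∀ z, g z ∈ Set.Icc u v) {X Y : Ω → ℝ} (hX : Measurable X)
    (hY : Measurable Y) (hYmem : ∀ ω, Y ω ∈ Set.Icc u v)
    (hcond : (fun ω => g (X ω)) =ᵐ[P] P[Y | MeasurableSpace.comap X inferInstance]) :
    ∫ ω, |f (X ω) - Y ω| ^ 2 ∂P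
      = ∫ ω, |f (X ω) - g (X ω)| ^ 2 ∂P + ∫ ω, |g (X ω) - Y ω| ^ 2 ∂P := by
  set h : Ω → ℝ := fun ω => f (X ω) - g (X ω) with hh
  have hfX := hfm.comp hX
  have hgX := hgm.comp hX
  have hhm : Measurable h := hfX.sub hgX
  have hhsm : StronglyMeasurable[MeasurableSpace.comap X inferInstance] h :=
    (((hfm.sub hgm).comp (comap_measurable X))).stronglyMeasurable
  have hhb : ∀ ω, ‖h ω‖ ≤ v - u := fun ω => by
    rw [Real.norm_eq_abs, abs_le]
    constructor <;> linarith [(hf (X ω)).1, (hf (X ω)).2, (hg (X ω)).1, (hg (X ω)).2]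
  have hYi : Integrable Y P := Integrable.of_mem_Icc u v hY.aemeasurable (ae_of_all _ hYmem)
  have hgi : Integrable (fun ω => g (X ω)) P :=
    Integrable.of_mem_Icc u v hgX.aemeasurable (ae_of_all _ fun ω => hg _)
  have hhY : Integrable (h * Y) P :=
    hYi.bdd_mul hhm.aestronglyMeasurable (ae_of_all _ hhb)
  have hhg : Integrable (fun ω => h ω * g (X ω)) P :=
    hgi.bdd_mul hhm.aestronglyMeasurable (ae_of_all _ hhb)
  -- Orthogonality: `h` is a function of `X`, so it can be pulled out of the conditional expectation
  -- of `Y`.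
  have hcross : ∫ ω, h ω * Y ω ∂P = ∫ ω, h ω * g (X ω) ∂P := by
    have h1 := condExp_mul_of_stronglyMeasurable_left hhsm hhY hYi
    have h2 := integral_condExp (μ := P) (f := h * Y) hX.comap_le
    change ∫ ω, (h * Y) ω ∂P = _
    rw [← h2]
    refine integral_congr_ae ?_
    filter_upwards [h1, hcond] with ω e1 e2
    rw [e1, Pi.mul_apply, e2]
  have i1 : Integrable (fun ω => |f (X ω) - g (X ω)| ^ 2) P :=
    Integrable.of_mem_Icc 0 ((v - u) ^ 2) ((hfX.sub hgX).abs.pow_const 2).aemeasurable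
      (ae_of_all _ fun ω => abs_sub_sq_mem_Icc (hf _) (hg _))
  have i2 : Integrable (fun ω => |g (X ω) - Y ω| ^ 2) P :=
    Integrable.of_mem_Icc 0 ((v - u) ^ 2) ((hgX.sub hY).abs.pow_const 2).aemeasurable
      (ae_of_all _ fun ω => abs_sub_sq_mem_Icc (hg _) (hYmem ω))
  have e : ∀ ω, |f (X ω) - Y ω| ^ 2 = (|f (X ω) - g (X ω)| ^ 2 + |g (X ω) - Y ω| ^ 2)
      + 2 * (h ω * g (X ω) - h ω * Y ω) := by
    intro ω
    simp only [sq_abs, hh]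
    ring
  simp only [e]
  have hhY' : Integrable (fun ω => h ω * Y ω) P := hhY
  have i12 : Integrable (fun ω => |f (X ω) - g (X ω)| ^ 2 + |g (X ω) - Y ω| ^ 2) P := i1.add i2
  have i3 : Integrable (fun ω => h ω * g (X ω) - h ω * Y ω) P := hhg.sub hhY'
  rw [integral_add i12 (i3.const_mul 2), integral_add i1 i2,
    integral_const_mul, integral_sub hhg hhY', ← hcross]
  simp

lemma sum_Icc_eq_paramCount (l : ℕ → ℕ) (L : ℕ) :
    ∑ i ∈ Finset.Icc 1 L, l i * (l (i - 1) + 1) = paramCount l L := by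
  induction L with
  | zero => simp [paramCount]
  | succ L ih => rw [Finset.sum_Icc_succ_top (by omega), ih, paramCount_succ, Nat.add_sub_cancel]

/-- A Lipschitz function on an interval extends to a continuous function with the same range. -/
lemma exists_continuous_extension {a b u v Lip : ℝ} (hab : a < b) {f : ℝ → ℝ}
    (hfmem : ∀ x ∈ Set.Icc a b, f x ∈ Set.Icc u v)
    (hf : ∀ x ∈ Set.Icc a b, ∀ y ∈ Set.Icc a b, |f x - f y| ≤ Lip * |x - y|) :
    ∃ g : ℝ → ℝ, Continuous g ∧ (∀ x, g x ∈ Set.Icc u v) ∧ ∀ x ∈ Set.Icc a b, g x = f x := by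
  have hmem : ∀ x, max a (min b x) ∈ Set.Icc a b := fun x =>
    ⟨le_max_left _ _, max_le hab.le (min_le_left _ _)⟩
  have hcont : ContinuousOn f (Set.Icc a b) := by
    refine LipschitzOnWith.continuousOn (K := Lip.toNNReal)
      (LipschitzOnWith.of_dist_le_mul fun x hx y hy => ?_)
    rw [Real.dist_eq, Real.dist_eq]
    exact (hf x hx y hy).trans
      (mul_le_mul_of_nonneg_right (Real.le_coe_toNNReal _) (abs_nonneg _))
  refine ⟨fun x => f (max a (min b x)), hcont.comp_continuous (by fun_prop) hmem,
    fun x => hfmem _ (hmem x), fun x hx => ?_⟩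
  simp only [min_eq_right hx.2, max_eq_right hx.1]

/-- Lower-order moments of a bounded nonnegative random variable from a higher `L^q`-bound. -/
lemma integral_rpow_rpow_le {Ω : Type*} [MeasurableSpace Ω] {P : Measure Ω}
    [IsProbabilityMeasure P] {f : Ω → ℝ} (hfm : Measurable f) {C : ℝ}
    (hf : ∀ ω, f ω ∈ Set.Icc 0 C) {p q B : ℝ} (hp : 0 < p) (hpq : p ≤ q) (hB : 0 ≤ B)
    (h : eLpNorm f (ENNReal.ofReal q) P ≤ ENNReal.ofReal B) :
    Integrable (fun ω => f ω ^ p) P ∧ (∫ ω, f ω ^ p ∂P) ^ (1 / p) ≤ B := by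
  have hmem : MemLp f (ENNReal.ofReal p) P :=
    MemLp.of_bound hfm.aestronglyMeasurable C (ae_of_all _ fun ω => by
      rw [Real.norm_eq_abs, abs_of_nonneg (hf ω).1]; exact (hf ω).2)
  have hp0 : ENNReal.ofReal p ≠ 0 := by simpa using hp
  have hnorm : ∀ ω, ‖f ω‖ ^ p = f ω ^ p := fun ω => by
    rw [Real.norm_eq_abs, abs_of_nonneg (hf ω).1]
  constructor
  · have := hmem.integrable_norm_rpow hp0 ENNReal.ofReal_ne_top
    rw [ENNReal.toReal_ofReal hp.le] at this
    simpa only [hnorm] using this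
  · have h1 := (eLpNorm_le_eLpNorm_of_exponent_le (μ := P) (ENNReal.ofReal_le_ofReal hpq)
      hfm.aestronglyMeasurable).trans h
    rw [hmem.eLpNorm_eq_integral_rpow_norm hp0 ENNReal.ofReal_ne_top,
      ENNReal.ofReal_le_ofReal_iff hB, ENNReal.toReal_ofReal hp.le] at h1
    simpa only [hnorm, one_div] using h1

/-- The random search rate in terms of the number of all parameters is bounded by the rate in terms
of depth and width. -/
lemma random_search_rate_le {L n K : ℕ} (hL : 1 ≤ L) (hn : 0 < n) (hK : 0 < K) {w c q δ : ℝ}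
    (hw : 1 ≤ w) (hnw : (n : ℝ) ≤ L * w ^ 2) (hc : 1 ≤ c) (hq : 1 ≤ q) (hδ : 0 ≤ δ) :
    2 * δ * (L * w ^ L * c ^ (L - 1) * c) * (2 * c * (q * (K : ℝ) ^ (-(1 / (n : ℝ)))))
      ≤ 4 * δ * L * w ^ L * c ^ (L + 1) * q / (K : ℝ) ^ ((L : ℝ)⁻¹ * (w ^ 2)⁻¹) := by
  have hK' : (1:ℝ) ≤ K := by exact_mod_cast hK
  have hn' : (0:ℝ) < n := by exact_mod_cast hn
  have h1 : (K : ℝ) ^ (-(1 / (n : ℝ))) ≤ (K : ℝ) ^ (-((L : ℝ)⁻¹ * (w ^ 2)⁻¹)) := by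
    refine Real.rpow_le_rpow_of_exponent_le hK' (neg_le_neg ?_)
    rw [← mul_inv, ← one_div]
    exact one_div_le_one_div_of_le hn' hnw
  have e1 : c ^ (L + 1) = c ^ (L - 1) * c * c := by
    rw [← pow_succ, ← pow_succ]; congr 1; omega
  have e2 : 2 * δ * (L * w ^ L * c ^ (L - 1) * c) * (2 * c * (q * (K : ℝ) ^ (-(1 / (n : ℝ)))))
      = 4 * δ * L * w ^ L * c ^ (L + 1) * q * (K : ℝ) ^ (-(1 / (n : ℝ))) := by
    rw [e1]; ring
  rw [e2, div_eq_mul_inv]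
  refine mul_le_mul_of_nonneg_left ?_ (by positivity)
  rwa [← Real.rpow_neg (by linarith)]

end ReluNet

/-! ### Assembly of the three error terms -/

theorem mainTheorem3
    (d L M K N : ℕ) (hM : 0 < M) (hK : 0 < K) (hN : 0 < N)
    (A p : ℝ) (hA : 0 < A) (hp : 0 < p)
    (Lip : ℝ) (hLip : 0 ≤ Lip)
    (a b u v : ℝ) (huv : u < v) (hab : a < b)
    (c : ℝ) (hc : 1 ≤ c ∧ |u| ≤ c ∧ |v| ≤ c ∧ |a| ≤ c ∧ |b| ≤ c ∧ 2 * Lip ≤ c)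
    (β : ℝ) (hβ : c ≤ β)
    (l : ℕ → ℕ) (hlpos : ∀ i ≤ L, 0 < l i)
    (S : Finset ℕ) (hS : S ⊆ Finset.range (N + 1)) (hS0 : 0 ∈ S)
    (hL : 2 ≤ L) (hl0 : l 0 = 1) (hlL : l L = 1) (hl1 : A + 2 ≤ (l 1 : ℝ))
    (hd : ∑ i ∈ Finset.Icc 1 L, l i * (l (i - 1) + 1) ≤ d)
    (hli : ∀ i, 2 ≤ i → i ≤ L - 1 → 2 ≤ l i)
    {Ω : Type*} [MeasurableSpace Ω] (P : Measure Ω) [IsProbabilityMeasure P]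
    (X Y : Fin M → Ω → ℝ)
    (hX : ∀ j, Measurable (X j)) (hY : ∀ j, Measurable (Y j))
    (hXmem : ∀ j ω, X j ω ∈ Set.Icc a b) (hYmem : ∀ j ω, Y j ω ∈ Set.Icc u v)
    (hXY_indep : iIndepFun (fun (j : Fin M) (ω : Ω) => (X j ω, Y j ω)) P)
    (hXY_ident : ∀ i j : Fin M,
      IdentDistrib (fun ω => (X i ω, Y i ω)) (fun ω => (X j ω, Y j ω)) P P)
    (E : ℝ → ℝ) (hEmem : ∀ x ∈ Set.Icc a b, E x ∈ Set.Icc u v)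
    (hEcond : (fun ω => E (X ⟨0, hM⟩ ω)) =ᵐ[P]
      P[Y ⟨0, hM⟩ | MeasurableSpace.comap (X ⟨0, hM⟩) inferInstance])
    (hELip : ∀ x ∈ Set.Icc a b, ∀ y ∈ Set.Icc a b, |E x - E y| ≤ Lip * |x - y|)
    (Θ : ℕ → ℕ → Ω → (Fin d → ℝ)) (hΘ : ∀ k n, Measurable (Θ k n))
    (κ : Ω → ℕ × ℕ) (hκ : Measurable κ)
    (hΘ_indep : iIndepFun (fun k : Fin K => Θ ((k : ℕ) + 1) 0) P)
    (hΘ_ident : ∀ i j : Fin K,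
      IdentDistrib (Θ ((i : ℕ) + 1) 0) (Θ ((j : ℕ) + 1) 0) P P)
    (hΘ_unif : pdf.IsUniform (Θ 1 0)
      (Set.Icc (fun _ : Fin d => -c) (fun _ : Fin d => c)) P volume)
    (R : (Fin d → ℝ) → Ω → ℝ)
    (hR : ∀ θ ω, R θ ω = ReluNet.empiricalRisk (ReluNet.realDNN L l hl0 hlL u v θ)
      (fun j => X j ω) (fun j => Y j ω))
    (hκ_mem : ∀ ω, (κ ω).1 ∈ Finset.Icc 1 K ∧ (κ ω).2 ∈ S ∧ ‖Θ (κ ω).1 (κ ω).2 ω‖ ≤ β)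
    (hκ_min : ∀ ω, ∀ k ∈ Finset.Icc 1 K, ∀ n ∈ S, ‖Θ k n ω‖ ≤ β →
      R (Θ (κ ω).1 (κ ω).2 ω) ω ≤ R (Θ k n ω) ω) :
    -- the integrals on the left-hand side are well defined
    (∀ θ : Fin d → ℝ, IntegrableOn
      (fun x => |ReluNet.realDNN L l hl0 hlL u v θ x - E x| ^ 2)
      (Set.Icc a b) (P.map (X ⟨0, hM⟩))) ∧
    Integrable (fun ω => (ReluNet.sqError a b (P.map (X ⟨0, hM⟩))
      (ReluNet.realDNN L l hl0 hlL u v (Θ (κ ω).1 (κ ω).2 ω)) E) ^ p) P ∧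
    -- the error estimate
    (∫ ω, (ReluNet.sqError a b (P.map (X ⟨0, hM⟩))
      (ReluNet.realDNN L l hl0 hlL u v (Θ (κ ω).1 (κ ω).2 ω)) E) ^ p ∂P) ^ (1 / p) ≤
      Lip ^ 2 * (b - a) ^ 2 / A ^ 2
      + 4 * (v - u) * (L : ℝ) * ((ReluNet.maxDim L l : ℝ) + 1) ^ L * c ^ (L + 1) * max p 1
        / (K : ℝ) ^ ((L : ℝ)⁻¹ * (((ReluNet.maxDim L l : ℝ) + 1) ^ 2)⁻¹)
      + 10 * (max (v - u) 1) ^ 2 * (L : ℝ) * ((ReluNet.maxDim L l : ℝ) + 1) ^ (3 / 2 : ℝ)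
        * max p (Real.log (4 * (M : ℝ) * β * c)) / Real.sqrt (M : ℝ) := by
  obtain ⟨hc1, hcu, hcv, hca, hcb, hcL⟩ := hc
  set w : ℝ := (ReluNet.maxDim L l : ℝ) + 1 with hw
  set j₀ : Fin M := ⟨0, hM⟩ with hj₀
  set μ := P.map (X j₀) with hμ
  set N : (Fin d → ℝ) → ℝ → ℝ := fun θ => ReluNet.realDNN L l hl0 hlL u v θ with hN
  have : IsProbabilityMeasure μ := Measure.isProbabilityMeasure_map (hX j₀).aemeasurable
  have hβ1 : 1 ≤ β := hc1.trans hβ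
  have hlw : ∀ j ≤ L, (l j : ℝ) + 1 ≤ w := by
    intro j hj
    have h1 : l j ≤ ReluNet.maxDim L l :=
      Finset.le_sup (f := l) (Finset.mem_range.2 (by omega))
    have h2 : (l j : ℝ) ≤ ReluNet.maxDim L l := by exact_mod_cast h1
    linarith
  have hw1 : 1 ≤ w := le_trans (by simp) (hlw 0 (Nat.zero_le _))
  rw [ReluNet.sum_Icc_eq_paramCount] at hd
  set n := ReluNet.paramCount l L with hn
  have hn0 : 0 < n := by
    have h1 := ReluNet.bias_index_lt l (k := 0) (i := 0) (hlpos 1 (by omega))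
    have h2 : ReluNet.paramCount l (0 + 1) ≤ n := ReluNet.paramCount_mono l (by omega)
    omega
  have hnw : (n : ℝ) ≤ L * w ^ 2 := by
    have := ReluNet.paramCount_add_one_le (by omega) hlw
    linarith
  have hNmem : ∀ θ x, N θ x ∈ Set.Icc u v := fun θ x =>
    ReluNet.realDNN_mem_Icc hl0 hlL (by omega) huv.le θ x
  have hNc : Continuous fun q : (Fin d → ℝ) × ℝ => N q.1 q.2 :=
    ReluNet.continuous_realDNN hl0 hlL u v
  have hNm : ∀ θ, Measurable (N θ) := fun θ =>
    hNc.measurable.comp (measurable_const.prodMk measurable_id)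
  have hXc : ∀ j ω, |X j ω| ≤ c := by
    intro j ω
    have h1 := hXmem j ω
    have h2 := abs_le.1 hca
    have h3 := abs_le.1 hcb
    exact abs_le.2 ⟨by linarith [h1.1], by linarith [h1.2]⟩
  -- Outside `[a, b]` nothing is known about `E`, not even measurability. The continuous `E'`
  -- replaces it, as the law of `X j₀` is carried by `[a, b]`.
  obtain ⟨E', hE'c, hE'mem, hE'E⟩ := ReluNet.exists_continuous_extension hab hEmem hELip
  have hμab : ∀ᵐ x ∂μ, x ∈ Set.Icc a b :=
    (ae_map_iff (hX j₀).aemeasurable measurableSet_Icc).2 (ae_of_all _ fun ω => hXmem j₀ ω)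
  have hsqm : ∀ θ, Measurable fun x => |N θ x - E' x| ^ 2 := fun θ =>
    ((hNm θ).sub hE'c.measurable).abs.pow_const 2
  have hsqmem : ∀ θ x, |N θ x - E' x| ^ 2 ∈ Set.Icc 0 ((v - u) ^ 2) := fun θ x =>
    ReluNet.abs_sub_sq_mem_Icc (hNmem θ x) (hE'mem x)
  have hsqi : ∀ θ, Integrable (fun x => |N θ x - E' x| ^ 2) μ := fun θ =>
    Integrable.of_mem_Icc 0 ((v - u) ^ 2) (hsqm θ).aemeasurable (ae_of_all _ (hsqmem θ))
  have hsq : ∀ θ, ReluNet.sqError a b μ (N θ) E = ∫ x, |N θ x - E' x| ^ 2 ∂μ := by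
    intro θ
    unfold ReluNet.sqError
    rw [setIntegral_congr_fun (g := fun x => |N θ x - E' x| ^ 2) measurableSet_Icc
      (fun x hx => by simp only [hE'E x hx]), Measure.restrict_eq_self_of_ae_mem hμab]
  have hsqmem' : ∀ θ, ReluNet.sqError a b μ (N θ) E ∈ Set.Icc 0 ((v - u) ^ 2) := by
    intro θ
    rw [hsq]
    refine ⟨integral_nonneg fun x => (hsqmem θ x).1, ?_⟩
    refine (integral_mono (hsqi θ) (integrable_const _) fun x => (hsqmem θ x).2).trans_eq ?_
    simp
  have hcond : (fun ω => E' (X j₀ ω)) =ᵐ[P]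
      P[Y j₀ | MeasurableSpace.comap (X j₀) inferInstance] := by
    refine Filter.EventuallyEq.trans (Filter.Eventually.of_forall fun ω => ?_) hEcond
    exact hE'E _ (hXmem j₀ ω)
  have hrisk : ∀ θ, ReluNet.sqError a b μ (N θ) E
      = ∫ ω, |N θ (X j₀ ω) - Y j₀ ω| ^ 2 ∂P - ∫ ω, |E' (X j₀ ω) - Y j₀ ω| ^ 2 ∂P := by
    intro θ
    rw [ReluNet.risk_eq_add (hNm θ) hE'c.measurable (hNmem θ) hE'mem (hX j₀) (hY j₀) (hYmem j₀)
      hcond, hsq, hμ, integral_map (hX j₀).aemeasurable (hsqm θ).aestronglyMeasurable]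
    ring
  -- approximation error
  obtain ⟨ϑ, hϑc, hϑ⟩ := ReluNet.exists_realDNN_close hl0 hlL hL (hlpos 1 (by omega)) hd hli hab
    hLip ⟨hc1, hcu, hcv, hca, hcb, hcL⟩ hEmem hELip
  have happrox : ReluNet.sqError a b μ (N ϑ) E ≤ Lip ^ 2 * (b - a) ^ 2 / A ^ 2 := by
    have hba : 0 < b - a := sub_pos.2 hab
    have hAl : Lip * ((b - a) / l 1) ≤ Lip * ((b - a) / A) := by
      gcongr
      linarith
    rw [hsq]
    refine (integral_mono_ae (hsqi ϑ) (integrable_const ((Lip * ((b - a) / A)) ^ 2)) ?_).trans_eq ?_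
    · filter_upwards [hμab] with x hx
      rw [hE'E x hx]
      exact pow_le_pow_left₀ (abs_nonneg _) ((hϑ x hx).trans hAl) 2
    · simp only [integral_const, probReal_univ, one_smul]
      field_simp
  -- generalisation error
  set q := max p 1 with hq
  have hq1 : 1 ≤ q := le_max_right _ _
  obtain ⟨G, hGm, hG, hGq⟩ := ReluNet.exists_generalization_bound (d := d) hM hl0 hlL hL huv hlw
    hc1 hβ1 hq1 hX hY hXc hYmem hXY_indep hXY_ident j₀
  have hlog : 1 ≤ Real.log (4 * (M : ℝ) * β * c) := by
    rw [Real.le_log_iff_exp_le (by positivity)]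
    have hM1 : (1:ℝ) ≤ M := by exact_mod_cast hM
    have h1 := Real.exp_one_lt_d9
    have h2 : 1 ≤ (M : ℝ) * β * c :=
      one_le_mul_of_one_le_of_one_le (one_le_mul_of_one_le_of_one_le hM1 hβ1) hc1
    nlinarith
  -- Since the logarithm is at least 1, replacing `p` by `q = max p 1` leaves this maximum
  -- unchanged.
  have hqlog : max q (Real.log (4 * (M : ℝ) * β * c)) = max p (Real.log (4 * (M : ℝ) * β * c)) := by
    rw [hq, max_assoc, max_eq_right hlog]
  rw [hqlog] at hGq
  -- optimisation error
  have hc0 : 0 < c := by linarith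
  have hunif : ∀ k : Fin K, pdf.IsUniform (Θ ((k : ℕ) + 1) 0)
      (Set.Icc (fun _ : Fin d => -c) (fun _ : Fin d => c)) P volume := by
    intro k
    have := (hΘ_ident k ⟨0, hK⟩).map_eq
    unfold pdf.IsUniform at hΘ_unif ⊢
    rw [this]
    exact hΘ_unif
  have hne : (Finset.univ : Finset (Fin K)).Nonempty := ⟨⟨0, hK⟩, Finset.mem_univ _⟩
  set Z : Ω → ℝ := fun ω => Finset.univ.inf' hne fun k : Fin K =>
    ReluNet.entryDist n (Θ ((k : ℕ) + 1) 0 ω) ϑ with hZ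
  have hZq := ReluNet.eLpNorm_inf_entryDist_le hn0 hd hK hc0
    (fun k : Fin K => hΘ ((k : ℕ) + 1) 0) hΘ_indep hunif hϑc hq1 hne
  have hZm : Measurable Z := by
    have h1 : Continuous fun x : Fin K → ℝ => Finset.univ.inf' hne fun k => x k :=
      Continuous.finset_inf'_apply hne fun k _ => continuous_apply k
    exact h1.measurable.comp (measurable_pi_lambda _ fun k =>
      (ReluNet.continuous_entryDist n ϑ).measurable.comp (hΘ _ _))
  set C : ℝ := 2 * (v - u) * (L * w ^ L * c ^ (L - 1) * c) with hC
  have huv0 : 0 < v - u := sub_pos.2 huv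
  have hC0 : 0 ≤ C := by positivity
  -- error decomposition
  set H : Ω → ℝ := fun ω => ReluNet.sqError a b μ (N (Θ (κ ω).1 (κ ω).2 ω)) E with hH
  have hdecomp : ∀ᵐ ω ∂P, H ω ≤ Lip ^ 2 * (b - a) ^ 2 / A ^ 2 + (C * Z ω + 2 * G ω) := by
    filter_upwards [ae_all_iff.2 fun k : Fin K => ReluNet.isUniform_ae_abs_le hc0 (hunif k)]
      with ω hω
    obtain ⟨k, _, hk⟩ := Finset.exists_mem_eq_inf' hne fun k : Fin K =>
      ReluNet.entryDist n (Θ ((k : ℕ) + 1) 0 ω) ϑ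
    -- The starting point nearest to `ϑ` is an admissible competitor: `0` lies in `S`, and almost
    -- surely its norm is at most `c ≤ β`.
    have hkmin := hκ_min ω ((k : ℕ) + 1) (Finset.mem_Icc.2 ⟨by omega, k.2⟩) 0 hS0
      ((pi_norm_le_iff_of_nonneg (by linarith)).2 fun i => (hω k i).trans hβ)
    -- Both vectors lie in the cube of radius `c`, so the Lipschitz constant involves `c` and not
    -- `β`.
    have hopt : |R (Θ ((k : ℕ) + 1) 0 ω) ω - R ϑ ω| ≤ C * Z ω := by
      rw [hR, hR]
      refine (ReluNet.empiricalRisk_sub_abs_le hM huv.le (hNmem _) (hNmem _)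
        (η := L * w ^ L * c ^ (L - 1) * c * Z ω) (fun j => hYmem j ω) fun j => ?_).trans_eq
        (by rw [hC]; ring)
      refine ReluNet.realDNN_sub_abs_le hl0 hlL hc1 hc1 ?_ (hXc j ω) hlw
        (fun i _ => ReluNet.abs_entry_le hc0.le (hω k) i)
        (fun i _ => ReluNet.abs_entry_le hc0.le hϑc i) fun i hi => ?_
      · simp only [hZ, hk]; exact norm_nonneg _
      · simp only [hZ, hk]; exact ReluNet.abs_entry_sub_le_entryDist _ _ hi
    have hg1 := hG (Θ (κ ω).1 (κ ω).2 ω) (fun j _ => ReluNet.abs_entry_le (by linarith)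
      (fun i => (norm_le_pi_norm _ i).trans (hκ_mem ω).2.2) j) ω
    have hg2 := hG ϑ (fun j _ => ReluNet.abs_entry_le (by linarith)
      (fun i => (hϑc i).trans hβ) j) ω
    rw [← hR] at hg1 hg2
    have e1 := hrisk (Θ (κ ω).1 (κ ω).2 ω)
    have e2 := hrisk ϑ
    have g1 := (abs_le.1 hg1).1
    have g2 := (abs_le.1 hg2).2
    have g3 := (abs_le.1 hopt).2
    simp only [hH]
    linarith
  have hHm : Measurable H := by
    have h1 : Measurable fun θ => ∫ x, |N θ x - E' x| ^ 2 ∂μ := by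
      refine (StronglyMeasurable.integral_prod_right' (ν := μ)
        (f := fun q : (Fin d → ℝ) × ℝ => |N q.1 q.2 - E' q.2| ^ 2) ?_).measurable
      exact ((hNc.sub (hE'c.comp continuous_snd)).abs.pow 2).stronglyMeasurable
    have h2 : Measurable fun ω => Θ (κ ω).1 (κ ω).2 ω := by
      -- The random index takes countably many values, so measurability for each fixed index
      -- suffices.
      have h3 : Measurable fun q : Ω × (ℕ × ℕ) => Θ q.2.1 q.2.2 q.1 :=
        measurable_from_prod_countable_left fun k => hΘ k.1 k.2
      exact h3.comp (measurable_id.prodMk hκ)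
    simp only [hH, hsq]
    exact h1.comp h2
  have hGn : eLpNorm (fun ω => 2 * G ω) (ENNReal.ofReal q) P ≤ ENNReal.ofReal
      (10 * (max (v - u) 1) ^ 2 * (L : ℝ) * w ^ (3 / 2 : ℝ)
        * max p (Real.log (4 * (M : ℝ) * β * c)) / Real.sqrt (M : ℝ)) := by
    have e : (fun ω => 2 * G ω) = (2 : ℝ) • G := rfl
    rw [e, eLpNorm_const_smul, Real.enorm_eq_ofReal zero_le_two]
    refine (mul_le_mul_right hGq _).trans_eq ?_
    rw [← ENNReal.ofReal_mul zero_le_two]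
    congr 1
    ring
  have hZn : eLpNorm (fun ω => C * Z ω) (ENNReal.ofReal q) P ≤ ENNReal.ofReal
      (4 * (v - u) * (L : ℝ) * w ^ L * c ^ (L + 1) * q
        / (K : ℝ) ^ ((L : ℝ)⁻¹ * (w ^ 2)⁻¹)) := by
    have e : (fun ω => C * Z ω) = C • Z := rfl
    rw [e, eLpNorm_const_smul, Real.enorm_eq_ofReal hC0]
    refine (mul_le_mul_right hZq _).trans ?_
    rw [← ENNReal.ofReal_mul hC0]
    exact ENNReal.ofReal_le_ofReal
      (ReluNet.random_search_rate_le (by omega) hn0 hK hw1 hnw hc1 hq1 huv0.le)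
  have hT0 : 0 ≤ max p (Real.log (4 * (M : ℝ) * β * c)) := hp.le.trans (le_max_left _ _)
  -- The estimate is made in `L^q` because the triangle inequality needs an exponent at least 1;
  -- monotonicity of norms on a probability space then gives `p`.
  have hbound : eLpNorm H (ENNReal.ofReal q) P ≤ ENNReal.ofReal
      (Lip ^ 2 * (b - a) ^ 2 / A ^ 2
      + 4 * (v - u) * (L : ℝ) * w ^ L * c ^ (L + 1) * q / (K : ℝ) ^ ((L : ℝ)⁻¹ * (w ^ 2)⁻¹)
      + 10 * (max (v - u) 1) ^ 2 * (L : ℝ) * w ^ (3 / 2 : ℝ)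
        * max p (Real.log (4 * (M : ℝ) * β * c)) / Real.sqrt (M : ℝ)) := by
    have hq1' : 1 ≤ ENNReal.ofReal q := ENNReal.one_le_ofReal.2 hq1
    have hA0 : 0 ≤ Lip ^ 2 * (b - a) ^ 2 / A ^ 2 := by positivity
    rw [ENNReal.ofReal_add (by positivity) (by positivity),
      ENNReal.ofReal_add hA0 (by positivity), add_assoc]
    refine (eLpNorm_mono_ae (g := fun ω => Lip ^ 2 * (b - a) ^ 2 / A ^ 2
      + (C * Z ω + 2 * G ω)) ?_).trans ?_
    · filter_upwards [hdecomp] with ω hω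
      rw [Real.norm_eq_abs, abs_of_nonneg (hsqmem' _).1]
      exact hω.trans (le_abs_self _)
    · refine (eLpNorm_add_le (f := fun _ => Lip ^ 2 * (b - a) ^ 2 / A ^ 2)
        (g := fun ω => C * Z ω + 2 * G ω) aestronglyMeasurable_const
        ((hZm.const_mul C).add (hGm.const_mul 2)).aestronglyMeasurable hq1').trans ?_
      refine add_le_add (le_of_eq ?_) ((eLpNorm_add_le (f := fun ω => C * Z ω)
        (g := fun ω => 2 * G ω) (hZm.const_mul C).aestronglyMeasurable
        (hGm.const_mul 2).aestronglyMeasurable hq1').trans (add_le_add hZn hGn))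
      rw [eLpNorm_const' _ (by simp; linarith) ENNReal.ofReal_ne_top, measure_univ,
        ENNReal.one_rpow, mul_one, Real.enorm_eq_ofReal hA0]
  obtain ⟨hint, hle⟩ := ReluNet.integral_rpow_rpow_le hHm (fun ω => hsqmem' _) hp
    (le_max_left p 1) (by positivity) hbound
  refine ⟨fun θ => ?_, hint, hle⟩
  refine ((hsqi θ).integrableOn (s := Set.Icc a b)).congr_fun (fun x hx => ?_) measurableSet_Icc
  simp only [hE'E x hx, hN]
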